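/- **Setting.** Let $\mathcal A$ be the complete theory of a first-order structure with carrier $\mathbb Z$ (with equality). A *(linear) constrained Horn clause* (CHC) has the form $\eta\wedge\psi\Rightarrow\eta'$, where $\eta$ is $\top$ or an atom $F(\vec X)$, $\eta'$ is $\bot$ or an atom $G(\vec Y)$, $F,G$ are uninterpreted predicates, all variables in $\vec X,\vec Y$ are pairwise different, and the condition $\psi$ is a quantifier-free formula in negation normal form over the signature of $\mathcal A$; all variables are universally quantified. It is a *fact* if only $\eta=\top$, a *query* if only $\eta'=\bot$, a *conditional empty clause* if both, a *rule* if neither, *recursive* if it is a rule with $F=G$, and *conjunctive* if $\psi$ is a conjunction of literals. A CHC problem is a set of CHCs; it is satisfiable if some interpretation of the predicates over $\mathbb Z$ satisfies all of its clauses. $\mathrm{grnd}(\eta\wedge\psi\Rightarrow\eta')=\{\eta\sigma\Rightarrow\eta'\sigma\mid\sigma\models\psi\}$; $\varphi\sqsubseteq\pi$ (resp. $\varphi\sqsubset\pi$) means $\mathrm{grnd}(\varphi)\subseteq\mathrm{grnd}(\pi)$ (resp. $\subsetneq$), and $\varphi\sqsubseteq\Pi$ (resp. $\varphi\sqsubset\Pi$)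 for a set $\Pi$ means that this holds for some $\pi\in\Pi$. The resolvent $\mathrm{res}$ of two clauses is $(\eta\wedge\psi\wedge\psi'\Rightarrow\eta')\theta$, if (after renaming apart) $\theta$ is the most general unifier of the head of the first clause $\eta\wedge\psi\Rightarrow F(\vec x)$ and the body of the second clause $F(\vec y)\wedge\psi'\Rightarrow\eta'$, and $\bot\Rightarrow\bot$ if they do not unify; non-empty sequences of clauses are identified with their iterated resolvents from left to right (so that the notions above apply to sequences), and $::$ denotes concatenation. $\mathrm{sip}(\Pi)$ is the set of all clauses obtained from some $\varphi\in\Pi$ and some model $\sigma$ of its condition by replacing the condition by the conjunction of all its literals that are true under $\sigma$. An *acceleration technique* is a function $\mathrm{accel}$ that maps each recursive conjunctive CHC $\varphi$ to a recursive conjunctive CHC with $\mathrm{grnd}(\mathrm{accel}(\varphi))=\bigcup_{n\ge1}\mathrm{grnd}(\varphi^n)$. **The calculus ADCL.** States are triples $(\Pi,[\varphi_1,\dots,\varphi_k],[B_0,\dots,B_k])$ of a set of clauses, a trace, and sets of blocking clauses. A clause $\varphi$ is *active* in a state if $\varphi\not\sqsubseteq B_k$ and the condition of $[\varphi_1,\dots,\varphi_k]::\varphi$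 is satisfiable. Let $\mathrm{bt}$ remove $\varphi_k$ and $B_k$ and add $\varphi_k$ to $B_{k-1}$. The rules are: - *Init*: $\Phi\leadsto(\Phi,[],[\varnothing])$. - *Step*: $(\Pi,\vec\varphi,\vec B)\leadsto(\Pi,\vec\varphi::\varphi,\vec B::\varnothing)$ if $\varphi\in\mathrm{sip}(\Pi)$ is active. - *Accelerate*: $(\Pi,\vec\varphi::\vec\varphi^{\circ},\vec B::\vec B^{\circ})\leadsto(\Pi\cup\{\varphi\},\vec\varphi::\varphi,\vec B::\{\varphi\})$ if $\vec\varphi^{\circ}$ is recursive, $|\vec\varphi^{\circ}|=|\vec B^{\circ}|$ and $\varphi=\mathrm{accel}(\vec\varphi^{\circ})$. - *Covered*: $s=(\Pi,\vec\varphi::\vec\varphi',\vec B)\leadsto\mathrm{bt}(s)$ if $\vec\varphi'$ is non-empty and $\vec\varphi'\sqsubset\mathrm{sip}(\Pi)$, or $\vec\varphi'\sqsubseteq\mathrm{sip}(\Pi)$ and $|\vec\varphi'|>1$. - *Backtrack*: $s=(\Pi,\vec\varphi::\varphi,\vec B)\leadsto\mathrm{bt}(s)$ if no rule or query from $\mathrm{sip}(\Pi)$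 is active and $\varphi$ is not a query. - *Refute*: $(\Pi,\vec\varphi,\vec B)\leadsto\mathsf{unsat}$ if $\vec\varphi$ is a conditional empty clause with satisfiable condition. - *Prove*: $(\Pi,[],[B])\leadsto\mathsf{sat}$ if no fact or conditional empty clause from $\mathrm{sip}(\Pi)$ is active. A derivation from $\Phi$ follows a *reasonable strategy* (written $\leadsto_{rs}$) if: (1) whenever the current state is $(\Pi,\vec\varphi::\vec\varphi',\vec B')$, some earlier state of the derivation is $(\Pi,\vec\varphi,\vec B)$ with the same $\Pi$, and $\vec\varphi'$ is as in *Covered*, then *Covered* is used; (2), (3) *Accelerate* is applied only to the shortest recursive suffix $\vec\varphi^{\circ}$ of the trace such that $\mathrm{accel}(\vec\varphi^{\circ})\not\sqsubseteq\mathrm{sip}(\Pi)$, and *Step* is used only if there is no such suffix; (4) if the trace is empty, then *Step* is applied only with facts or conditional empty clauses. **Theorem 4 (Non-Termination).** There is a finite satisfiable CHC problem $\Phi$ over linear integer arithmetic such that, for every acceleration technique $\mathrm{accel}$ over any theory $\mathcal A$ of an expansion of $(\mathbb Z,0,1,-,+,\le)$, we have $\Phi\not\leadsto_{rs}^*\mathsf{sat}$.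 Moreover, $\leadsto_{rs}$ does not terminate: there is an infinite derivation $\Phi\leadsto_{rs}s_1\leadsto_{rs}s_2\leadsto_{rs}\cdots$, and $\leadsto_{rs}$ is not even normalizing: no derivation from $\Phi$ with a reasonable strategy ends in a normal form of $\leadsto_{rs}$. -/

import Mathlib

open FirstOrder

universe u v

namespace ADCL

/-! ### The theory of linear integer arithmetic -/

/-- Function symbols of linear integer arithmetic. -/
inductive LIAFunc : ℕ → Type
  | zero : LIAFunc 0
  | one : LIAFunc 0
  | neg : LIAFunc 1
  | add : LIAFunc 2

/-- Relation symbols of linear integer arithmetic (equality is logical). -/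
inductive LIARel : ℕ → Type
  | le : LIARel 2

/-- The signature `0, 1, -, +, ≤` of linear integer arithmetic. -/
def LIA : FirstOrder.Language.{0, 0} where
  Functions := LIAFunc
  Relations := LIARel

/-- The standard model: the integers. Every integer is the value of a ground term. -/
instance : LIA.Structure ℤ where
  funMap := fun {_} f =>
    match f with
    | LIAFunc.zero => fun _ => 0
    | LIAFunc.one => fun _ => 1
    | LIAFunc.neg => fun x => -x 0
    | LIAFunc.add => fun x => x 0 + x 1
  RelMap := fun {_} r =>
    match r with
    | LIARel.le => fun x => x 0 ≤ x 1

/-! ### Quantifier-free conditions in negation normal form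

Variables are natural numbers. A background theory is the complete theory of a structure with
carrier `ℤ` for a signature `L`. -/

/-- Literals: equations, atoms `R(t₁,…,tₙ)`, and their negations. -/
inductive Literal (L : FirstOrder.Language.{u, v}) : Type (max u v)
  | eq (s t : L.Term ℕ) : Literal L
  | ne (s t : L.Term ℕ) : Literal L
  | rel {n : ℕ} (R : L.Relations n) (ts : Fin n → L.Term ℕ) : Literal L
  | nrel {n : ℕ} (R : L.Relations n) (ts : Fin n → L.Term ℕ) : Literal L

/-- Quantifier-free formulas in negation normal form. -/
inductive NNF (L : FirstOrder.Language.{u, v}) : Type (max u v)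
  | tru : NNF L
  | fls : NNF L
  | lit (ℓ : Literal L) : NNF L
  | and (ψ₁ ψ₂ : NNF L) : NNF L
  | or (ψ₁ ψ₂ : NNF L) : NNF L

section Formulas

variable {L : FirstOrder.Language.{u, v}}

/-- Truth of a literal under a valuation of the variables. -/
def Literal.Holds [L.Structure ℤ] (σ : ℕ → ℤ) : Literal L → Prop
  | .eq s t => s.realize σ = t.realize σ
  | .ne s t => s.realize σ ≠ t.realize σ
  | .rel R ts => FirstOrder.Language.Structure.RelMap R (fun i => (ts i).realize σ)
  | .nrel R ts => ¬ FirstOrder.Language.Structure.RelMap R (fun i => (ts i).realize σ)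

/-- Truth of a formula under a valuation of the variables. -/
def NNF.Holds [L.Structure ℤ] (σ : ℕ → ℤ) : NNF L → Prop
  | .tru => True
  | .fls => False
  | .lit ℓ => ℓ.Holds σ
  | .and ψ₁ ψ₂ => ψ₁.Holds σ ∧ ψ₂.Holds σ
  | .or ψ₁ ψ₂ => ψ₁.Holds σ ∨ ψ₂.Holds σ

/-- The (occurrences of) literals of a formula. -/
def NNF.literals : NNF L → List (Literal L)
  | .tru => []
  | .fls => []
  | .lit ℓ => [ℓ]
  | .and ψ₁ ψ₂ => ψ₁.literals ++ ψ₂.literals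
  | .or ψ₁ ψ₂ => ψ₁.literals ++ ψ₂.literals

/-- Replacing variables by variables. -/
def Literal.rename (ρ : ℕ → ℕ) : Literal L → Literal L
  | .eq s t => .eq (s.relabel ρ) (t.relabel ρ)
  | .ne s t => .ne (s.relabel ρ) (t.relabel ρ)
  | .rel R ts => .rel R (fun i => (ts i).relabel ρ)
  | .nrel R ts => .nrel R (fun i => (ts i).relabel ρ)

/-- Replacing variables by variables. -/
def NNF.rename (ρ : ℕ → ℕ) : NNF L → NNF L
  | .tru => .tru
  | .fls => .fls
  | .lit ℓ => .lit (ℓ.rename ρ)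
  | .and ψ₁ ψ₂ => .and (ψ₁.rename ρ) (ψ₂.rename ρ)
  | .or ψ₁ ψ₂ => .or (ψ₁.rename ρ) (ψ₂.rename ρ)

end Formulas

section Translation

universe u' v'

variable {L : FirstOrder.Language.{u, v}} {L' : FirstOrder.Language.{u', v'}}

/-- Reading a literal in a richer signature. -/
def Literal.map (i : L →ᴸ L') : Literal L → Literal L'
  | .eq s t => .eq (i.onTerm s) (i.onTerm t)
  | .ne s t => .ne (i.onTerm s) (i.onTerm t)
  | .rel R ts => .rel (i.onRelation R) (fun j => i.onTerm (ts j))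
  | .nrel R ts => .nrel (i.onRelation R) (fun j => i.onTerm (ts j))

/-- Reading a formula in a richer signature. -/
def NNF.map (i : L →ᴸ L') : NNF L → NNF L'
  | .tru => .tru
  | .fls => .fls
  | .lit ℓ => .lit (ℓ.map i)
  | .and ψ₁ ψ₂ => .and (ψ₁.map i) (ψ₂.map i)
  | .or ψ₁ ψ₂ => .or (ψ₁.map i) (ψ₂.map i)

end Translation

/-! ### Linear constrained Horn clauses -/

/-- Atoms `F(X₁,…,Xₙ)` over the uninterpreted predicate symbols `P`. -/
structure Atom (P : Type) where
  pred : P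
  args : List ℕ

/-- Replacing variables by variables. -/
def Atom.rename {P : Type} (ρ : ℕ → ℕ) (a : Atom P) : Atom P :=
  ⟨a.pred, a.args.map ρ⟩

/-- The argument variables of an atom that may be absent. -/
def argVars {P : Type} : Option (Atom P) → List ℕ
  | none => []
  | some a => a.args

/-- Ground atoms. -/
abbrev GAtom (P : Type) := P × List ℤ

/-- The ground instance of an atom under a valuation. -/
def Atom.ground {P : Type} (σ : ℕ → ℤ) (a : Atom P) : GAtom P :=
  (a.pred, a.args.map σ)

/-- A linear constrained Horn clause `body ∧ cond ⟹ head`. An absent body atom is `⊤`, an absent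
head atom is `⊥`, and the list `cond` stands for the conjunction of its members. All arguments of
predicates are pairwise different variables. -/
structure CHC (L : FirstOrder.Language.{u, v}) {P : Type} (ar : P → ℕ) where
  body : Option (Atom P)
  cond : List (NNF L)
  head : Option (Atom P)
  body_arity : ∀ a ∈ body, a.args.length = ar a.pred
  head_arity : ∀ a ∈ head, a.args.length = ar a.pred
  nodup : (argVars body ++ argVars head).Nodup

theorem argVars_map_rename {P : Type} (ρ : ℕ → ℕ) (o : Option (Atom P)) :
    argVars (o.map (Atom.rename ρ)) = (argVars o).map ρ := by
  cases o <;> rfl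

theorem rename_arity {P : Type} {ar : P → ℕ} (ρ : ℕ → ℕ) {o : Option (Atom P)}
    (h : ∀ a ∈ o, a.args.length = ar a.pred) :
    ∀ a ∈ o.map (Atom.rename ρ), a.args.length = ar a.pred := by
  cases o with
  | none => simp
  | some a =>
    intro b hb
    obtain rfl : Atom.rename ρ a = b := by simpa using hb
    simpa [Atom.rename] using h a (by simp)

namespace CHC

section Basic

universe u' v'

variable {L : FirstOrder.Language.{u, v}} {L' : FirstOrder.Language.{u', v'}} {P : Type} {ar : P → ℕ}

/-- Facts `ψ ⟹ G(Y)`. -/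
def IsFact (φ : CHC L ar) : Prop := φ.body = none ∧ φ.head ≠ none

/-- Rules `F(X) ∧ ψ ⟹ G(Y)`. -/
def IsRule (φ : CHC L ar) : Prop := φ.body ≠ none ∧ φ.head ≠ none

/-- Queries `F(X) ∧ ψ ⟹ ⊥`. -/
def IsQuery (φ : CHC L ar) : Prop := φ.body ≠ none ∧ φ.head = none

/-- Conditional empty clauses `ψ ⟹ ⊥`. -/
def IsCondEmpty (φ : CHC L ar) : Prop := φ.body = none ∧ φ.head = none

/-- Recursive clauses: rules `F(X) ∧ ψ ⟹ F(Y)`. -/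
def IsRecursive (φ : CHC L ar) : Prop :=
  ∃ a ∈ φ.body, ∃ b ∈ φ.head, a.pred = b.pred

/-- Conjunctive clauses: the condition is a conjunction of literals (conjunctions of literals are
always written as a flat list of literals). -/
def IsConjunctive (φ : CHC L ar) : Prop :=
  ∀ ψ ∈ φ.cond, ∃ ℓ, ψ = NNF.lit ℓ

/-- Reading a clause in a richer signature. -/
def map (i : L →ᴸ L') (φ : CHC L ar) : CHC L' ar :=
  { body := φ.body
    cond := φ.cond.map (NNF.map i)
    head := φ.head
    body_arity := φ.body_arity
    head_arity := φ.head_arity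
    nodup := φ.nodup }

/-- The clause `⊥ ⟹ ⊥`. -/
def bot : CHC L ar :=
  { body := none
    cond := [NNF.fls]
    head := none
    body_arity := by simp
    head_arity := by simp
    nodup := by simp [argVars] }

/-- The head of `φ` unifies with the body of `φ'` after renaming apart. -/
def Unifies (φ φ' : CHC L ar) : Prop :=
  ∃ a ∈ φ.head, ∃ b ∈ φ'.body, a.pred = b.pred

/-- The variables `v` of the first clause are renamed to `2 * v`. -/
def renL (v : ℕ) : ℕ := 2 * v

/-- The variables `v` of the second clause are renamed to `2 * v + 1`, followed by the most general
unifier, which replaces each argument variable of its body by the corresponding (renamed) argument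
variable of the head of the first clause. -/
def renR (φ φ' : CHC L ar) (v : ℕ) : ℕ :=
  if v ∈ argVars φ'.body then renL ((argVars φ.head).getD ((argVars φ'.body).idxOf v) 0)
  else 2 * v + 1

theorem nodup_res (φ φ' : CHC L ar) :
    (argVars (φ.body.map (Atom.rename renL)) ++
      argVars (φ'.head.map (Atom.rename (renR φ φ')))).Nodup := by
  have h1 := φ.nodup
  have h2 := φ'.nodup
  rw [List.nodup_append] at h1 h2
  have key : ∀ v ∈ argVars φ'.head, renR φ φ' v = 2 * v + 1 := by
    intro v hv
    have : v ∉ argVars φ'.body := fun h => h2.2.2 v h v hv rfl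
    simp [renR, this]
  rw [argVars_map_rename, argVars_map_rename, List.map_congr_left key, List.nodup_append]
  refine ⟨h1.1.map (fun a b h => ?_), h2.2.1.map (fun a b h => ?_), ?_⟩
  · simp only [renL] at h; omega
  · omega
  · simp only [List.mem_map, renL]
    rintro _ ⟨a, -, rfl⟩ _ ⟨b, -, rfl⟩
    omega

open Classical in
/-- The resolvent of two clauses. -/
noncomputable def res (φ φ' : CHC L ar) : CHC L ar :=
  if Unifies φ φ' then
    { body := φ.body.map (Atom.rename renL)
      cond := φ.cond.map (NNF.rename renL) ++ φ'.cond.map (NNF.rename (renR φ φ'))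
      head := φ'.head.map (Atom.rename (renR φ φ'))
      body_arity := rename_arity _ φ.body_arity
      head_arity := rename_arity _ φ'.head_arity
      nodup := nodup_res φ φ' }
  else bot

/-- The resolvent of a non-empty sequence of clauses (with the dummy value `⊥ ⟹ ⊥` for the empty
sequence). -/
noncomputable def resSeq : List (CHC L ar) → CHC L ar
  | [] => bot
  | φ :: l => l.foldl res φ

end Basic

section Semantics

variable {L : FirstOrder.Language.{u, v}} [L.Structure ℤ] {P : Type} {ar : P → ℕ}

/-- The valuation `σ` satisfies the condition of `φ`. -/
def CondHolds (φ : CHC L ar) (σ : ℕ → ℤ) : Prop :=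
  ∀ ψ ∈ φ.cond, ψ.Holds σ

/-- The condition of `φ` is satisfiable. -/
def CondSat (φ : CHC L ar) : Prop := ∃ σ, φ.CondHolds σ

/-- The ground instances of a clause. -/
def grnd (φ : CHC L ar) : Set (Option (GAtom P) × Option (GAtom P)) :=
  {g | ∃ σ : ℕ → ℤ, φ.CondHolds σ ∧
    g = (φ.body.map (Atom.ground σ), φ.head.map (Atom.ground σ))}

/-- Refutations. -/
def IsRefutation (φ : CHC L ar) : Prop := φ.IsCondEmpty ∧ φ.CondSat

/-- The interpretation `I` of the predicate symbols satisfies `φ`. -/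
def Models (I : GAtom P → Prop) (φ : CHC L ar) : Prop :=
  ∀ σ : ℕ → ℤ, (∀ a ∈ φ.body, I (a.ground σ)) → φ.CondHolds σ → ∃ a ∈ φ.head, I (a.ground σ)

open Classical in
/-- The clause that results from `φ` by replacing its condition by the conjunction of all literals
of the condition that are true under `σ`. -/
noncomputable def sipAt (φ : CHC L ar) (σ : ℕ → ℤ) : CHC L ar :=
  { φ with cond := ((φ.cond.flatMap NNF.literals).filter (fun ℓ => ℓ.Holds σ)).map NNF.lit }

/-- Redundancy: `φ ⊑ π`. -/
def Red (φ π : CHC L ar) : Prop := φ.grnd ⊆ π.grnd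

/-- Strict redundancy: `φ ⊏ π`. -/
def SRed (φ π : CHC L ar) : Prop := φ.grnd ⊂ π.grnd

end Semantics

end CHC

section Calculus

variable {L : FirstOrder.Language.{u, v}} [L.Structure ℤ] {P : Type} {ar : P → ℕ}

/-- A CHC problem is satisfiable if some interpretation of the predicates satisfies all clauses. -/
def Satisfiable (Φ : Set (CHC L ar)) : Prop :=
  ∃ I : GAtom P → Prop, ∀ φ ∈ Φ, φ.Models I

/-- Syntactic implicant projection of a set of clauses. -/
def sip (Φ : Set (CHC L ar)) : Set (CHC L ar) :=
  {π | ∃ φ ∈ Φ, ∃ σ : ℕ → ℤ, φ.CondHolds σ ∧ π = φ.sipAt σ}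

/-- `φ` is redundant w.r.t. some clause of `Φ`. -/
def RedSet (φ : CHC L ar) (Φ : Set (CHC L ar)) : Prop := ∃ π ∈ Φ, φ.Red π

/-- `φ` is strictly redundant w.r.t. some clause of `Φ`. -/
def SRedSet (φ : CHC L ar) (Φ : Set (CHC L ar)) : Prop := ∃ π ∈ Φ, φ.SRed π

/-- Acceleration techniques. -/
def IsAcceleration (accel : CHC L ar → CHC L ar) : Prop :=
  ∀ φ : CHC L ar, φ.IsRecursive → φ.IsConjunctive →
    (accel φ).IsRecursive ∧ (accel φ).IsConjunctive ∧
    (accel φ).grnd = ⋃ n ≥ 1, (CHC.resSeq (List.replicate n φ)).grnd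

variable (L ar) in
/-- The objects related by the calculus: CHC problems, states consisting of a clause set, a trace
`[φ₁,…,φₖ]` and sets `[B₀,…,Bₖ]` of blocking clauses, and the two final results. -/
inductive Config : Type (max u v)
  | problem (Φ : Set (CHC L ar)) : Config
  | state (C : Set (CHC L ar)) (trace : List (CHC L ar)) (B : List (Set (CHC L ar))) : Config
  | sat : Config
  | unsat : Config

/-- `φ` is blocked: it is redundant w.r.t. the last set of blocking clauses. -/
def Blocked (B : List (Set (CHC L ar))) (φ : CHC L ar) : Prop :=
  ∃ b ∈ B.getLast?, RedSet φ b

/-- `φ` is active: it is not blocked and it can extend the trace. -/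
def Active (trace : List (CHC L ar)) (B : List (Set (CHC L ar))) (φ : CHC L ar) : Prop :=
  ¬ Blocked B φ ∧ (CHC.resSeq (trace ++ [φ])).CondSat

/-- The condition on the non-empty suffix `sfx` of the trace in the rule `covered`. -/
def Coverable (C : Set (CHC L ar)) (sfx : List (CHC L ar)) : Prop :=
  sfx ≠ [] ∧ (SRedSet (CHC.resSeq sfx) (sip C) ∨
    (RedSet (CHC.resSeq sfx) (sip C) ∧ 1 < sfx.length))

/-- The backtrack function as a relation: the last clause `φ` of the trace is removed and added to
the blocking clauses of the remaining trace. -/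
inductive Bt : Config L ar → Config L ar → Prop
  | mk (C : Set (CHC L ar)) (t : List (CHC L ar)) (φ : CHC L ar) (B : List (Set (CHC L ar)))
      (b b' : Set (CHC L ar)) :
      Bt (.state C (t ++ [φ]) (B ++ [b, b'])) (.state C t (B ++ [b ∪ {φ}]))

/-- `sfx` is a recursive suffix of the trace `t` whose acceleration is not redundant. -/
def AccelCandidate (accel : CHC L ar → CHC L ar) (C : Set (CHC L ar))
    (t sfx : List (CHC L ar)) : Prop :=
  sfx <:+ t ∧ (CHC.resSeq sfx).IsRecursive ∧ ¬ RedSet (accel (CHC.resSeq sfx)) (sip C)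

/-- The rules of the calculus, without the name of the rule but with its parameters where a
strategy depends on them. -/
inductive Rule (L : FirstOrder.Language.{u, v}) {P : Type} (ar : P → ℕ) : Type (max u v)
  | init : Rule L ar
  | step (φ : CHC L ar) : Rule L ar
  | accelerate (sfx : List (CHC L ar)) : Rule L ar
  | covered : Rule L ar
  | backtrack : Rule L ar
  | refute : Rule L ar
  | prove : Rule L ar

/-- The calculus: `Step accel r c c'` means that `c ↝ c'` by the rule `r`. -/
inductive Step (accel : CHC L ar → CHC L ar) : Rule L ar → Config L ar → Config L ar → Prop
  | init (Φ : Set (CHC L ar)) :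
      Step accel .init (.problem Φ) (.state Φ [] [∅])
  | step (C : Set (CHC L ar)) (t : List (CHC L ar)) (B : List (Set (CHC L ar))) (φ : CHC L ar)
      (hφ : φ ∈ sip C) (hact : Active t B φ) :
      Step accel (.step φ) (.state C t B) (.state C (t ++ [φ]) (B ++ [∅]))
  | accelerate (C : Set (CHC L ar)) (t sfx : List (CHC L ar)) (B B' : List (Set (CHC L ar)))
      (φ : CHC L ar) (hrec : (CHC.resSeq sfx).IsRecursive) (hlen : sfx.length = B'.length)
      (hφ : accel (CHC.resSeq sfx) = φ) :
      Step accel (.accelerate sfx) (.state C (t ++ sfx) (B ++ B'))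
        (.state (C ∪ {φ}) (t ++ [φ]) (B ++ [{φ}]))
  | covered (C : Set (CHC L ar)) (t sfx : List (CHC L ar)) (B : List (Set (CHC L ar)))
      (c' : Config L ar) (hcov : Coverable C sfx) (hbt : Bt (.state C (t ++ sfx) B) c') :
      Step accel .covered (.state C (t ++ sfx) B) c'
  | backtrack (C : Set (CHC L ar)) (t : List (CHC L ar)) (φ : CHC L ar)
      (B : List (Set (CHC L ar))) (c' : Config L ar)
      (hinact : ∀ π ∈ sip C, π.IsRule ∨ π.IsQuery → ¬ Active (t ++ [φ]) B π)
      (hφ : ¬ φ.IsQuery) (hbt : Bt (.state C (t ++ [φ]) B) c') :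
      Step accel .backtrack (.state C (t ++ [φ]) B) c'
  | refute (C : Set (CHC L ar)) (t : List (CHC L ar)) (B : List (Set (CHC L ar)))
      (href : (CHC.resSeq t).IsRefutation) :
      Step accel .refute (.state C t B) .unsat
  | prove (C : Set (CHC L ar)) (b : Set (CHC L ar))
      (hinact : ∀ π ∈ sip C, π.IsFact ∨ π.IsCondEmpty → ¬ Active [] [b] π) :
      Step accel .prove (.state C [] [b]) .sat

/-- In the current state `c` of a derivation whose earlier elements are `h`, a coverable sequence
has been appended to the trace of an earlier state without learning a clause in between. -/
def CoverForced (h : List (Config L ar)) (c : Config L ar) : Prop :=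
  ∃ (C : Set (CHC L ar)) (t sfx : List (CHC L ar)) (B B' : List (Set (CHC L ar))),
    Config.state C t B ∈ h ∧ c = .state C (t ++ sfx) B' ∧ Coverable C sfx

/-- The restrictions that a reasonable strategy imposes on the use of the rule `r` in the current
state `c` of a derivation whose earlier elements are `h`. -/
structure Reasonable (accel : CHC L ar → CHC L ar) (h : List (Config L ar)) (c : Config L ar)
    (r : Rule L ar) : Prop where
  /-- If a redundant sequence was added to the trace, then `covered` is used. -/
  covered : CoverForced h c → r = .covered
  /-- Acceleration has preference over steps. -/
  accel_first : ∀ C t B φ, c = .state C t B → r = .step φ →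
    ¬ ∃ sfx, AccelCandidate accel C t sfx
  /-- Only the shortest recursive suffix with a non-redundant acceleration is accelerated. -/
  shortest : ∀ C t B sfx, c = .state C t B → r = .accelerate sfx →
    AccelCandidate accel C t sfx ∧
      ∀ sfx', AccelCandidate accel C t sfx' → sfx.length ≤ sfx'.length
  /-- The trace starts with a fact or a conditional empty clause. -/
  start : ∀ C B φ, c = .state C [] B → r = .step φ → φ.IsFact ∨ φ.IsCondEmpty

/-- One step of the calculus with a reasonable strategy, from the last element `c` of a derivation
with the earlier elements `h`. -/
def RsStep (accel : CHC L ar → CHC L ar) (h : List (Config L ar)) (c c' : Config L ar) : Prop :=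
  ∃ r, Step accel r c c' ∧ Reasonable accel h c r

/-- `RsDeriv accel Φ h c`: the sequence `h ++ [c]` is a derivation from `Φ` with a reasonable
strategy. -/
inductive RsDeriv (accel : CHC L ar → CHC L ar) (Φ : Set (CHC L ar)) :
    List (Config L ar) → Config L ar → Prop
  | start : RsDeriv accel Φ [] (.problem Φ)
  | snoc (h : List (Config L ar)) (c c' : Config L ar) (hd : RsDeriv accel Φ h c)
      (hs : RsStep accel h c c') : RsDeriv accel Φ (h ++ [c]) c'

end Calculus

end ADCL

namespace ADCL

/-! ### Ground semantics of conditions and resolvents -/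

section ClauseLemmas

universe u' v'

variable {L : FirstOrder.Language.{u, v}} {L' : FirstOrder.Language.{u', v'}}
  {P : Type} {ar : P → ℕ}

/-! Words over four letters are coded as integers in bijective base four. The problem consists of a
fact for `0`, one rule per letter that appends this letter, and a query for negative numbers, which
is never reached. Every learned rule appends the words of some language: resolution is
concatenation, and any acceleration technique has to produce `W⁺` from `W`.

Call a language admissible if it is non-empty, lacks the empty word and contains at most one
square-free word. Products preserve this, and so does `W⁺`: a square-free product of at least two
words of `W` would begin with two square-free, hence equal, words of `W`, that is, with a square
(`Admissible.mul`, `Admissible.kplus`). But there is an infinite square-free word over four letters,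
the pairs of consecutive Thue–Morse values. Hence finitely many clauses never cover all of its
prefixes.

The remaining work shows that the fact, once on the trace, is never removed. No suffix containing it
is coverable (`not_coverable_fact_cons`), so it could only go if every rule were blocked after it. A
rule `b` is blocked there only if it is strictly redundant, or if, for every letter `c`, `b`
followed by `c` is redundant or the rule for `c` is redundant w.r.t. `b` (`JustifiedOne`). This
comes from a similar analysis one level deeper (`JustifiedTwo`), where the preference for
acceleration over steps makes the resolvent of the two rules redundant. If all rules were blocked, a
maximal clause covering one prefix would yield a clause covering the next, so all prefixes would be
covered (`not_all_blocked_one`), which is absurd.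

Thus `sat` and `unsat` are unreachable, and every reachable configuration has a successor
(`ConfigInv.exists_rsStep`). -/

theorem Literal.holds_rename [L.Structure ℤ] (σ : ℕ → ℤ) (ρ : ℕ → ℕ) (ℓ : Literal L) :
    (ℓ.rename ρ).Holds σ ↔ ℓ.Holds (σ ∘ ρ) := by
  cases ℓ <;> simp [Literal.rename, Literal.Holds, Language.Term.realize_relabel]

theorem NNF.holds_rename [L.Structure ℤ] (σ : ℕ → ℤ) (ρ : ℕ → ℕ) (ψ : NNF L) :
    (ψ.rename ρ).Holds σ ↔ ψ.Holds (σ ∘ ρ) := by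
  induction ψ with
  | tru | fls => rfl
  | lit ℓ => exact ℓ.holds_rename σ ρ
  | and _ _ h₁ h₂ => exact and_congr h₁ h₂
  | or _ _ h₁ h₂ => exact or_congr h₁ h₂

theorem Literal.holds_map [L.Structure ℤ] [L'.Structure ℤ] (i : L →ᴸ L') [i.IsExpansionOn ℤ]
    (σ : ℕ → ℤ) (ℓ : Literal L) : (ℓ.map i).Holds σ ↔ ℓ.Holds σ := by
  cases ℓ <;> simp [Literal.map, Literal.Holds]

theorem NNF.holds_map [L.Structure ℤ] [L'.Structure ℤ] (i : L →ᴸ L') [i.IsExpansionOn ℤ]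
    (σ : ℕ → ℤ) (ψ : NNF L) : (ψ.map i).Holds σ ↔ ψ.Holds σ := by
  induction ψ with
  | tru | fls => rfl
  | lit ℓ => exact ℓ.holds_map i σ
  | and _ _ h₁ h₂ => exact and_congr h₁ h₂
  | or _ _ h₁ h₂ => exact or_congr h₁ h₂

@[simp]
theorem Atom.ground_rename (σ : ℕ → ℤ) (ρ : ℕ → ℕ) (a : Atom P) :
    (a.rename ρ).ground σ = a.ground (σ ∘ ρ) := by
  simp [Atom.ground, Atom.rename]

namespace CHC

theorem condSat_iff_grnd_nonempty [L.Structure ℤ] (φ : CHC L ar) :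
    φ.CondSat ↔ φ.grnd.Nonempty :=
  ⟨fun ⟨σ, h⟩ => ⟨_, σ, h, rfl⟩, fun ⟨_, σ, h, _⟩ => ⟨σ, h⟩⟩

@[simp]
theorem grnd_bot [L.Structure ℤ] : (bot : CHC L ar).grnd = ∅ := by
  ext g
  simp [grnd, CondHolds, bot, NNF.Holds]

theorem grnd_map [L.Structure ℤ] [L'.Structure ℤ] (i : L →ᴸ L') [i.IsExpansionOn ℤ]
    (φ : CHC L ar) : (φ.map i).grnd = φ.grnd := by
  ext g
  simp [grnd, CondHolds, map, NNF.holds_map]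

theorem IsConjunctive.map {φ : CHC L ar} (h : φ.IsConjunctive) (i : L →ᴸ L') :
    (φ.map i).IsConjunctive := by
  intro ψ hψ
  obtain ⟨χ, hχ, rfl⟩ := List.mem_map.1 hψ
  obtain ⟨ℓ, rfl⟩ := h χ hχ
  exact ⟨ℓ.map i, rfl⟩

theorem isRule_of_isRecursive {φ : CHC L ar} (h : φ.IsRecursive) : φ.IsRule := by
  obtain ⟨a, ha, b, hb, -⟩ := h
  simp only [Option.mem_def] at ha hb
  simp [IsRule, ha, hb]

/-- Body arguments are pairwise different, so `idxOf` finds the right position and the unifier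
matches arguments position by position. -/
theorem map_renR {φ φ' : CHC L ar} {a b : Atom P} (ha : a ∈ φ.head) (hb : b ∈ φ'.body)
    (h : a.pred = b.pred) : b.args.map (renR φ φ') = a.args.map renL := by
  have hla := φ.head_arity a ha
  have hlb := φ'.body_arity b hb
  have hnd := φ'.nodup
  simp only [Option.mem_def] at ha hb
  rw [List.nodup_append, hb] at hnd
  have hlen : b.args.length = a.args.length := by rw [hla, hlb, h]
  refine List.ext_getElem (by simp [hlen]) fun n h₁ h₂ => ?_
  simp only [List.length_map] at h₁ h₂
  have := hnd.1
  simp only [argVars] at this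
  simp [renR, ha, hb, argVars, List.Nodup.idxOf_getElem this, h₂]

/-- Resolution is composition of ground relations. This also covers clauses that do not unify, where
both sides fail, and it lets later arguments ignore variables and renamings. -/
theorem mem_grnd_res [L.Structure ℤ] {φ φ' : CHC L ar}
    {g : Option (GAtom P) × Option (GAtom P)} :
    g ∈ (res φ φ').grnd ↔ ∃ a, (g.1, some a) ∈ φ.grnd ∧ (some a, g.2) ∈ φ'.grnd := by
  constructor
  · rintro ⟨σ, hσ, rfl⟩
    by_cases hu : Unifies φ φ'
    · rw [res, if_pos hu] at hσ ⊢
      obtain ⟨a, ha, b, hb, hab⟩ := hu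
      have hm := map_renR ha hb hab
      simp only [Option.mem_def] at ha hb
      refine ⟨a.ground (σ ∘ renL), ⟨σ ∘ renL, fun ψ hψ => ?_, ?_⟩,
        ⟨σ ∘ renR φ φ', fun ψ hψ => ?_, ?_⟩⟩
      · rw [← NNF.holds_rename]
        exact hσ _ (by simpa using Or.inl ⟨ψ, hψ, rfl⟩)
      · simp [ha, Function.comp_def]
      · rw [← NNF.holds_rename]
        exact hσ _ (by simpa using Or.inr ⟨ψ, hψ, rfl⟩)
      · simp only [hb, Option.map_some, Option.map_map, Prod.mk.injEq, Option.some.injEq]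
        refine ⟨?_, ?_⟩
        · simp only [Atom.ground, hab, ← List.map_map, hm]
        · simp [Function.comp_def]
    · rw [res, if_neg hu] at hσ
      exact absurd (hσ NNF.fls (by simp [bot])) id
  · rintro ⟨g₀, ⟨σ₁, h₁, e₁⟩, ⟨σ₂, h₂, e₂⟩⟩
    obtain ⟨d₁, e₁'⟩ := Prod.mk.inj e₁
    obtain ⟨e₂, d₂⟩ := Prod.mk.inj e₂
    obtain ⟨a, ha, rfl⟩ := Option.map_eq_some_iff.1 e₁'.symm
    obtain ⟨b, hb, hab⟩ := Option.map_eq_some_iff.1 e₂.symm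
    have hp : a.pred = b.pred := (congrArg Prod.fst hab).symm
    have hargs : b.args.map σ₂ = a.args.map σ₁ := congrArg Prod.snd hab
    have hm := map_renR (φ := φ) (φ' := φ') ha hb hp
    have hu : Unifies φ φ' := ⟨a, ha, b, hb, hp⟩
    -- Even variables come from the first clause and odd ones from the second; halving undoes either
    -- renaming.
    let σ : ℕ → ℤ := fun v => if v % 2 = 0 then σ₁ (v / 2) else σ₂ (v / 2)
    have hL : σ ∘ renL = σ₁ := by
      funext v
      simp [σ, renL]
    have hR : σ ∘ renR φ φ' = σ₂ := by
      funext v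
      -- Body arguments are redirected to head arguments of the first clause, where both valuations
      -- agree because the ground atoms coincide.
      by_cases hv : v ∈ b.args
      · have : b.args.map (σ ∘ renR φ φ') = b.args.map σ₂ := by
          rw [← List.map_map, hm, List.map_map, hL, hargs]
        exact List.map_inj_left.1 this v hv
      · have hv' : v ∉ argVars φ'.body := by rw [hb]; exact hv
        have e : (2 * v + 1) / 2 = v := by omega
        simp [σ, renR, hv', e]
    refine ⟨σ, ?_, ?_⟩
    · rw [res, if_pos hu]
      intro ψ hψ
      rcases List.mem_append.1 hψ with hψ | hψ
      · obtain ⟨χ, hχ, rfl⟩ := List.mem_map.1 hψ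
        rw [NNF.holds_rename, hL]
        exact h₁ χ hχ
      · obtain ⟨χ, hχ, rfl⟩ := List.mem_map.1 hψ
        rw [NNF.holds_rename, hR]
        exact h₂ χ hχ
    · rw [res, if_pos hu]
      refine Prod.ext ?_ ?_
      · simp [d₁, Atom.ground_rename, hL, Function.comp_def _ (Atom.rename _)]
      · simp [d₂, Atom.ground_rename, hR, Function.comp_def _ (Atom.rename _)]

theorem Red.res [L.Structure ℤ] {φ π φ' π' : CHC L ar} (h : φ.Red π) (h' : φ'.Red π') :
    (res φ φ').Red (res π π') := by
  intro g hg
  obtain ⟨a, ha, ha'⟩ := mem_grnd_res.1 hg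
  exact mem_grnd_res.2 ⟨a, h ha, h' ha'⟩

theorem resSeq_append_singleton {t : List (CHC L ar)} (ht : t ≠ []) (φ : CHC L ar) :
    resSeq (t ++ [φ]) = res (resSeq t) φ := by
  cases t with
  | nil => exact absurd rfl ht
  | cons a t => simp [resSeq]

theorem IsConjunctive.res {φ φ' : CHC L ar} (h : φ.IsConjunctive) (h' : φ'.IsConjunctive)
    (hu : Unifies φ φ') : (res φ φ').IsConjunctive := by
  rw [CHC.res, if_pos hu]
  intro ψ hψ
  rcases List.mem_append.1 hψ with hψ | hψ <;> obtain ⟨χ, hχ, rfl⟩ := List.mem_map.1 hψ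
  · obtain ⟨ℓ, rfl⟩ := h χ hχ
    exact ⟨_, rfl⟩
  · obtain ⟨ℓ, rfl⟩ := h' χ hχ
    exact ⟨_, rfl⟩

theorem body_res_eq_none {φ φ' : CHC L ar} (h : φ.body = none) : (res φ φ').body = none := by
  unfold res
  split_ifs <;> simp [h, bot]

theorem body_resSeq_eq_none {φ : CHC L ar} (h : φ.body = none) (t : List (CHC L ar)) :
    (resSeq (φ :: t)).body = none := by
  induction t using List.reverseRecOn with
  | nil => exact h
  | append_singleton t π ih =>
    rw [← List.cons_append, resSeq_append_singleton (List.cons_ne_nil _ _)]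
    exact body_res_eq_none ih

theorem IsConjunctive.sipAt_eq [L.Structure ℤ] {φ : CHC L ar} (h : φ.IsConjunctive) {σ : ℕ → ℤ}
    (hσ : φ.CondHolds σ) : φ.sipAt σ = φ := by
  have key : ∀ l : List (NNF L), (∀ ψ ∈ l, ∃ ℓ, ψ = NNF.lit ℓ) → (∀ ψ ∈ l, ψ.Holds σ) →
      ((l.flatMap NNF.literals).filter (fun ℓ => @decide (ℓ.Holds σ)
        (Classical.propDecidable _))).map NNF.lit = l := by
    intro l
    induction l with
    | nil => simp
    | cons ψ l ih =>
      intro h₁ h₂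
      obtain ⟨ℓ, rfl⟩ := h₁ ψ (by simp)
      have hℓ : ℓ.Holds σ := h₂ _ List.mem_cons_self
      simp only [List.flatMap_cons, NNF.literals, List.singleton_append]
      rw [List.filter_cons_of_pos (by simpa using hℓ), List.map_cons,
        ih (fun ψ hψ => h₁ ψ (by simp [hψ])) (fun ψ hψ => h₂ ψ (by simp [hψ]))]
  unfold sipAt
  rw [key φ.cond h hσ]

end CHC

/-- A model of a conjunction makes all its literals true, so projection drops nothing. All clause
sets met later are of this kind, which removes `sip` from the analysis. -/
theorem sip_eq_self [L.Structure ℤ] {C : Set (CHC L ar)}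
    (h : ∀ φ ∈ C, φ.IsConjunctive ∧ φ.CondSat) : sip C = C := by
  ext π
  constructor
  · rintro ⟨φ, hφ, σ, hσ, rfl⟩
    rwa [(h φ hφ).1.sipAt_eq hσ]
  · intro hπ
    obtain ⟨hc, σ, hσ⟩ := h π hπ
    exact ⟨π, hπ, σ, hσ, (hc.sipAt_eq hσ).symm⟩

end ClauseLemmas

/-! ### The Thue–Morse sequence and an infinite square-free word -/

section Words

/-- A word without a non-empty factor of the form `u ++ u`. -/
def SquareFreeWord {α : Type*} (w : List α) : Prop :=
  ∀ u, u ≠ [] → ¬ (u ++ u) <:+: w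

theorem SquareFreeWord.of_infix {α : Type*} {v w : List α} (hw : SquareFreeWord w)
    (h : v <:+: w) : SquareFreeWord v :=
  fun u hu hi => hw u hu (hi.trans h)

/-- The Thue–Morse sequence. -/
def thueMorse (n : ℕ) : Bool :=
  if n = 0 then false else xor (decide (n % 2 = 1)) (thueMorse (n / 2))
decreasing_by omega

theorem thueMorse_two_mul (n : ℕ) : thueMorse (2 * n) = thueMorse n := by
  rcases Nat.eq_zero_or_pos n with rfl | hn
  · rfl
  · rw [thueMorse]
    simp [hn.ne']

theorem thueMorse_two_mul_add_one (n : ℕ) : thueMorse (2 * n + 1) = !thueMorse n := by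
  rw [thueMorse]
  have : (2 * n + 1) / 2 = n := by omega
  simp [Nat.add_mod, this]

/-- Three consecutive positions contain a block `2k, 2k + 1`, and the two values in a block differ.
-/
theorem not_thueMorse_three_eq (n : ℕ) :
    ¬ (thueMorse n = thueMorse (n + 1) ∧ thueMorse (n + 1) = thueMorse (n + 2)) := by
  rintro ⟨h₁, h₂⟩
  obtain ⟨m, rfl | rfl⟩ := Nat.even_or_odd' n
  · rw [thueMorse_two_mul, thueMorse_two_mul_add_one] at h₁
    simp at h₁
  · rw [show 2 * m + 1 + 1 = 2 * (m + 1) by ring, show 2 * m + 1 + 2 = 2 * (m + 1) + 1 by ring,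
      thueMorse_two_mul, thueMorse_two_mul_add_one] at h₂
    simp at h₂

theorem thueMorse_eq_of_odd_ne {m : ℕ} (h : thueMorse (2 * m + 1) ≠ thueMorse (2 * m + 2)) :
    thueMorse m = thueMorse (m + 1) := by
  rw [show 2 * m + 2 = 2 * (m + 1) by ring, thueMorse_two_mul, thueMorse_two_mul_add_one] at h
  revert h
  cases thueMorse m <;> cases thueMorse (m + 1) <;> simp

theorem thueMorse_even_ne (m : ℕ) : thueMorse (2 * m) ≠ thueMorse (2 * m + 1) := by
  rw [thueMorse_two_mul, thueMorse_two_mul_add_one]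
  simp

/-- The Thue–Morse sequence has no overlaps. -/
theorem thueMorse_overlapFree (p : ℕ) (hp : 0 < p) (i : ℕ) :
    ¬ ∀ j ≤ p, thueMorse (i + j) = thueMorse (i + j + p) := by
  induction p using Nat.strong_induction_on generalizing i with
  | _ p ih =>
  intro h
  obtain ⟨q, rfl | rfl⟩ := Nat.even_or_odd' p
  -- Even period: sampling every other position, all of one parity, gives an overlap with half the
  -- period.
  · obtain ⟨m, rfl | rfl⟩ := Nat.even_or_odd' i
    · refine ih q (by omega) (by omega) m fun j hj => ?_
      have := h (2 * j) (by omega)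
      rwa [show 2 * m + 2 * j + 2 * q = 2 * (m + j + q) by ring,
        show 2 * m + 2 * j = 2 * (m + j) by ring, thueMorse_two_mul, thueMorse_two_mul] at this
    · refine ih q (by omega) (by omega) m fun j hj => ?_
      have := h (2 * j) (by omega)
      rw [show 2 * m + 1 + 2 * j + 2 * q = 2 * (m + j + q) + 1 by ring,
        show 2 * m + 1 + 2 * j = 2 * (m + j) + 1 by ring, thueMorse_two_mul_add_one,
        thueMorse_two_mul_add_one] at this
      simpa using this
  · have h' : ∀ k, i ≤ k → k ≤ i + (2 * q + 1) →
        thueMorse k = thueMorse (k + (2 * q + 1)) := by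
      intro k hk hk'
      have := h (k - i) (by omega)
      rwa [Nat.add_sub_cancel' hk] at this
    -- Odd period: the shift moves a block, whose values differ, onto a pair straddling two blocks,
    -- which forces equality of two neighbours at half scale. Two consecutive blocks in the window
    -- then give three equal values.
    have key : ∀ m, i ≤ 2 * m → 2 * m + 1 ≤ i + (2 * q + 1) →
        thueMorse (m + q) = thueMorse (m + q + 1) := by
      intro m h₁ h₂
      refine thueMorse_eq_of_odd_ne ?_
      have e₁ := h' (2 * m) h₁ (by omega)
      have e₂ := h' (2 * m + 1) (by omega) h₂
      rw [show 2 * m + (2 * q + 1) = 2 * (m + q) + 1 by ring] at e₁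
      rw [show 2 * m + 1 + (2 * q + 1) = 2 * (m + q) + 2 by ring] at e₂
      rw [← e₁, ← e₂]
      exact thueMorse_even_ne m
    have two : ∀ m, i ≤ 2 * m → 2 * m + 3 ≤ i + (2 * q + 1) → False := by
      intro m h₁ h₂
      refine not_thueMorse_three_eq (m + q) ⟨key m h₁ (by omega), ?_⟩
      have := key (m + 1) (by omega) (by omega)
      rwa [show m + 1 + q = m + q + 1 by ring] at this
    rcases Nat.eq_zero_or_pos q with rfl | hq
    · exact not_thueMorse_three_eq i ⟨h 0 (by omega), h 1 (by omega)⟩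
    · obtain ⟨m, hm | hm⟩ := Nat.even_or_odd' i
      · exact two m hm.le (by omega)
      · rcases Nat.lt_or_ge 1 q with hq' | hq'
        · exact two (m + 1) (by omega) (by omega)
        · obtain rfl : q = 1 := by omega
          subst hm
          have e : ∀ j ≤ 3, thueMorse (2 * m + 1 + j) = thueMorse (2 * m + 1 + j + 3) := h
          refine not_thueMorse_three_eq m ⟨thueMorse_eq_of_odd_ne ?_, thueMorse_eq_of_odd_ne ?_⟩
          · rw [e 0 (by omega), show 2 * m + 2 = 2 * m + 1 + 1 by ring, e 1 (by omega)]
            exact thueMorse_even_ne (m + 2)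
          · rw [show 2 * (m + 1) + 1 = 2 * m + 1 + 2 by ring,
              show 2 * (m + 1) + 2 = 2 * m + 1 + 3 by ring, e 2 (by omega), e 3 (by omega)]
            exact thueMorse_even_ne (m + 3)

/-- The letters of the alphabet. -/
abbrev Letter : Type := Bool × Bool

/-- An infinite square-free word over four letters. -/
def sqfreeSeq (n : ℕ) : Letter := (thueMorse n, thueMorse (n + 1))

/-- The prefix of length `n` of an infinite square-free word. -/
def sqfreePrefix (n : ℕ) : List Letter := (List.range n).map sqfreeSeq

@[simp]
theorem length_sqfreePrefix (n : ℕ) : (sqfreePrefix n).length = n := by simp [sqfreePrefix]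

theorem sqfreePrefix_succ (n : ℕ) : sqfreePrefix (n + 1) = sqfreePrefix n ++ [sqfreeSeq n] := by
  simp [sqfreePrefix, List.range_succ]

theorem squareFreeWord_sqfreePrefix (n : ℕ) : SquareFreeWord (sqfreePrefix n) := by
  rintro u hu ⟨s, t, h⟩
  have hp : 0 < u.length := List.length_pos_iff.2 hu
  have hlen := congrArg List.length h
  simp only [List.length_append, length_sqfreePrefix] at hlen
  have get : ∀ k, k < n → (s ++ (u ++ u) ++ t)[k]? = some (sqfreeSeq k) := by
    intro k hk
    rw [h]
    simp [sqfreePrefix, hk]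
  have key : ∀ j < u.length, sqfreeSeq (s.length + j) = sqfreeSeq (s.length + j + u.length) := by
    intro j hj
    have h₁ := get (s.length + j) (by omega)
    have h₂ := get (s.length + j + u.length) (by omega)
    rw [List.append_assoc, List.append_assoc, List.getElem?_append_right (by omega),
      List.getElem?_append_left (by omega)] at h₁
    rw [List.append_assoc, List.append_assoc, List.getElem?_append_right (by omega),
      List.getElem?_append_right (by omega), List.getElem?_append_left (by omega)] at h₂
    rw [show s.length + j + u.length - s.length - u.length = s.length + j - s.length by omega,
      h₁] at h₂
    exact Option.some.inj h₂
  -- A square of pairs is an overlap of Thue–Morse values: first components give the equalities for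
  -- `j < |u|`, and the second component of the last pair gives the one for `j = |u|`.
  refine thueMorse_overlapFree u.length hp s.length fun j hj => ?_
  rcases hj.lt_or_eq with hj | rfl
  · exact congrArg Prod.fst (key j hj)
  · have := congrArg Prod.snd (key (u.length - 1) (by omega))
    simp only [sqfreeSeq] at this
    rwa [show s.length + (u.length - 1) + 1 = s.length + u.length by omega,
      show s.length + (u.length - 1) + u.length + 1 = s.length + u.length + u.length by omega]
      at this

/-! ### Languages with at most one square-free word -/

theorem squareFreeWord_singleton {α : Type*} (a : α) : SquareFreeWord [a] := by
  intro u hu hi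
  have := hi.length_le
  have := List.length_pos_iff.2 hu
  simp at *
  omega

/-- A non-empty language of non-empty words with at most one square-free word. -/
structure Admissible {α : Type*} (W : _root_.Language α) : Prop where
  nonempty : ∃ w, w ∈ W
  nil_notMem : [] ∉ W
  unique : ∀ u ∈ W, ∀ v ∈ W, SquareFreeWord u → SquareFreeWord v → u = v

/-- Factors of a square-free word are square-free, so uniqueness determines both factors. -/
theorem Admissible.mul {α : Type*} {W V : _root_.Language α} (hW : Admissible W)
    (hV : Admissible V) : Admissible (W * V) where
  nonempty := by
    obtain ⟨w, hw⟩ := hW.nonempty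
    obtain ⟨v, hv⟩ := hV.nonempty
    exact ⟨w ++ v, Language.append_mem_mul hw hv⟩
  nil_notMem h := by
    obtain ⟨w, hw, v, hv, e⟩ := Language.mem_mul.1 h
    rw [List.append_eq_nil_iff] at e
    exact hW.nil_notMem (e.1 ▸ hw)
  unique u hu v hv su sv := by
    obtain ⟨u₁, hu₁, u₂, hu₂, rfl⟩ := Language.mem_mul.1 hu
    obtain ⟨v₁, hv₁, v₂, hv₂, rfl⟩ := Language.mem_mul.1 hv
    rw [hW.unique u₁ hu₁ v₁ hv₁ (su.of_infix (List.prefix_append _ _).isInfix)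
        (sv.of_infix (List.prefix_append _ _).isInfix),
      hV.unique u₂ hu₂ v₂ hv₂ (su.of_infix (List.suffix_append _ _).isInfix)
        (sv.of_infix (List.suffix_append _ _).isInfix)]

/-- The words that are concatenations of at least one word of `W`. -/
def kplus {α : Type*} (W : _root_.Language α) : _root_.Language α := {w | ∃ n ≥ 1, w ∈ W ^ n}

/-- With at least two factors, the first two are square-free words of `W`, hence equal, and form a
square. So acceleration contributes no new square-free word. -/
theorem Admissible.mem_of_mem_pow {α : Type*} {W : _root_.Language α} (hW : Admissible W)
    {n : ℕ} (hn : 1 ≤ n) {w : List α} (hw : w ∈ W ^ n) (sw : SquareFreeWord w) : w ∈ W := by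
  obtain _ | _ | n := n
  · omega
  · simpa using hw
  · rw [pow_succ', pow_succ'] at hw
    obtain ⟨a, ha, v, hv, rfl⟩ := Language.mem_mul.1 hw
    obtain ⟨b, hb, c, hc, rfl⟩ := Language.mem_mul.1 hv
    have hab : a = b := hW.unique a ha b hb (sw.of_infix (List.prefix_append _ _).isInfix)
      (sw.of_infix ⟨a, c, by simp⟩)
    subst hab
    refine absurd ⟨[], c, by simp⟩ (sw a ?_)
    rintro rfl
    exact hW.nil_notMem ha

theorem Admissible.nil_notMem_pow {α : Type*} {W : _root_.Language α} (hW : Admissible W)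
    {n : ℕ} (hn : 1 ≤ n) : [] ∉ W ^ n := by
  obtain _ | n := n
  · omega
  · rw [pow_succ']
    intro h
    obtain ⟨a, ha, v, hv, e⟩ := Language.mem_mul.1 h
    rw [List.append_eq_nil_iff] at e
    exact hW.nil_notMem (e.1 ▸ ha)

theorem Admissible.kplus {α : Type*} {W : _root_.Language α} (hW : Admissible W) :
    Admissible (kplus W) where
  nonempty := by
    obtain ⟨w, hw⟩ := hW.nonempty
    exact ⟨w, 1, le_rfl, by simpa using hw⟩
  nil_notMem := fun ⟨_, hn, h⟩ => hW.nil_notMem_pow hn h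
  unique := fun u ⟨_, hn, hu⟩ v ⟨_, hm, hv⟩ su sv =>
    hW.unique u (hW.mem_of_mem_pow hn hu su) v (hW.mem_of_mem_pow hm hv sv) su sv

theorem Admissible.singleton {α : Type*} (a : α) :
    Admissible ({[a]} : _root_.Language α) where
  nonempty := ⟨[a], rfl⟩
  nil_notMem := by
    intro h
    cases h
  unique := by
    rintro u rfl v rfl - -
    rfl

end Words

/-! ### Words as integers, clauses as languages -/

section Representation

/-- The unary predicate symbol applied to `x`. -/
def pt (x : ℤ) : GAtom Unit := ((), [x])

theorem pt_injective : Function.Injective pt := by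
  intro x y h
  simpa [pt] using h

/-- The arity of the only predicate symbol. -/
abbrev unary : Unit → ℕ := fun _ => 1

/-- The digit of a letter in bijective base four. -/
def Letter.digit (c : Letter) : ℕ := 1 + 2 * c.1.toNat + c.2.toNat

theorem Letter.digit_injective : Function.Injective Letter.digit := by decide

theorem Letter.digit_bounds (c : Letter) : 1 ≤ c.digit ∧ c.digit ≤ 4 := by
  revert c; decide

/-- The number that results from `x` by appending the digits of `w` in base four. -/
def appendWord (x : ℤ) (w : List Letter) : ℤ := w.foldl (fun y c => 4 * y + c.digit) x

@[simp]
theorem appendWord_nil (x : ℤ) : appendWord x [] = x := rfl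

theorem appendWord_append (x : ℤ) (w v : List Letter) :
    appendWord x (w ++ v) = appendWord (appendWord x w) v := by
  simp [appendWord]

@[simp]
theorem appendWord_singleton (x : ℤ) (c : Letter) : appendWord x [c] = 4 * x + c.digit := rfl

theorem appendWord_zero_nonneg (w : List Letter) : 0 ≤ appendWord 0 w := by
  induction w using List.reverseRecOn with
  | nil => simp
  | append_singleton w c ih =>
    rw [appendWord_append, appendWord_singleton]
    positivity

theorem appendWord_zero_pos {w : List Letter} (hw : w ≠ []) : 0 < appendWord 0 w := by
  obtain ⟨w, c, rfl⟩ := List.eq_nil_or_concat w |>.resolve_left hw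
  have := appendWord_zero_nonneg w
  have := c.digit_bounds.1
  rw [List.concat_eq_append, appendWord_append, appendWord_singleton]
  omega

/-- The digits 1 to 4 represent each residue modulo 4 once, so the value determines the last letter;
without a digit 0, only the empty word has value 0. -/
theorem appendWord_zero_injective : Function.Injective (appendWord 0) := by
  intro w
  induction w using List.reverseRecOn with
  | nil =>
    intro v h
    by_contra hv
    exact (appendWord_zero_pos (Ne.symm hv)).ne (by simpa using h)
  | append_singleton w c ih =>
    intro v h
    rcases List.eq_nil_or_concat v with rfl | ⟨v, d, rfl⟩
    · exact absurd h (appendWord_zero_pos (by simp)).ne'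
    · simp only [List.concat_eq_append, appendWord_append, appendWord_singleton] at h ⊢
      have hc := c.digit_bounds
      have hd := d.digit_bounds
      have h₁ : c.digit = d.digit := by omega
      have h₂ : appendWord 0 w = appendWord 0 v := by omega
      rw [ih h₂, Letter.digit_injective h₁]

/-- The ground rules that append a word of `W`. -/
def wordRel (W : _root_.Language Letter) : Set (Option (GAtom Unit) × Option (GAtom Unit)) :=
  {g | ∃ x, ∃ w ∈ W, g = (some (pt x), some (pt (appendWord x w)))}

theorem wordRel_subset_iff {W V : _root_.Language Letter} : wordRel W ⊆ wordRel V ↔ W ≤ V := by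
  constructor
  · intro h w hw
    -- The instance starting at 0 suffices, since from there the result determines the word.
    obtain ⟨x, v, hv, e⟩ := h ⟨0, w, hw, rfl⟩
    simp only [Prod.mk.injEq, Option.some.injEq, pt_injective.eq_iff] at e
    obtain ⟨rfl, e⟩ := e
    rwa [appendWord_zero_injective e]
  · rintro h g ⟨x, w, hw, rfl⟩
    exact ⟨x, w, h hw, rfl⟩

variable {L : FirstOrder.Language.{u, v}} [L.Structure ℤ]

/-- The clause `φ` appends the words of an admissible language `W`. -/
structure Represents (φ : CHC L unary) (W : _root_.Language Letter) : Prop where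
  recursive : φ.IsRecursive
  conjunctive : φ.IsConjunctive
  grnd_eq : φ.grnd = wordRel W
  admissible : Admissible W

/-- The clause `φ` appends the words of some admissible language. -/
def Appends (φ : CHC L unary) : Prop := ∃ W, Represents φ W

namespace Represents

theorem red_iff {φ π : CHC L unary} {W V : _root_.Language Letter} (h : Represents φ W)
    (h' : Represents π V) : φ.Red π ↔ W ≤ V := by
  rw [CHC.Red, h.grnd_eq, h'.grnd_eq, wordRel_subset_iff]

theorem condSat {φ : CHC L unary} {W : _root_.Language Letter} (h : Represents φ W) :
    φ.CondSat := by
  obtain ⟨w, hw⟩ := h.admissible.nonempty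
  rw [CHC.condSat_iff_grnd_nonempty, h.grnd_eq]
  exact ⟨_, 0, w, hw, rfl⟩

theorem grnd_res {φ π : CHC L unary} {W V : _root_.Language Letter} (h : φ.grnd = wordRel W)
    (h' : π.grnd = wordRel V) : (CHC.res φ π).grnd = wordRel (W * V) := by
  ext g
  rw [CHC.mem_grnd_res, h, h']
  constructor
  · rintro ⟨a, ⟨x, w, hw, e⟩, ⟨y, v, hv, e'⟩⟩
    obtain ⟨e₁, e₂⟩ := Prod.mk.inj e
    obtain ⟨e₃, e₄⟩ := Prod.mk.inj e'
    obtain rfl := pt_injective (Option.some.inj (e₂.symm.trans e₃))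
    exact ⟨x, w ++ v, Language.append_mem_mul hw hv,
      Prod.ext e₁ (by rw [e₄, appendWord_append])⟩
  · rintro ⟨x, _, hwv, rfl⟩
    obtain ⟨w, hw, v, hv, rfl⟩ := Language.mem_mul.1 hwv
    exact ⟨pt (appendWord x w), ⟨x, w, hw, rfl⟩,
      ⟨appendWord x w, v, hv, by rw [appendWord_append]⟩⟩

theorem res {φ π : CHC L unary} {W V : _root_.Language Letter} (h : Represents φ W)
    (h' : Represents π V) : Represents (CHC.res φ π) (W * V) := by
  obtain ⟨a, ha, b, hb, -⟩ := h.recursive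
  obtain ⟨a', ha', b', hb', -⟩ := h'.recursive
  have hu : CHC.Unifies φ π := ⟨b, hb, a', ha', rfl⟩
  refine ⟨?_, h.conjunctive.res h'.conjunctive hu, grnd_res h.grnd_eq h'.grnd_eq,
    h.admissible.mul h'.admissible⟩
  rw [CHC.res, if_pos hu]
  exact ⟨_, Option.mem_map_of_mem _ ha, _, Option.mem_map_of_mem _ hb', rfl⟩

theorem grnd_replicate {φ : CHC L unary} {W : _root_.Language Letter} (h : Represents φ W)
    (n : ℕ) : (CHC.resSeq (List.replicate (n + 1) φ)).grnd = wordRel (W ^ (n + 1)) := by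
  induction n with
  | zero => simpa [CHC.resSeq] using h.grnd_eq
  | succ n ih =>
    rw [List.replicate_succ', CHC.resSeq_append_singleton (by simp), pow_succ]
    exact grnd_res ih h.grnd_eq

/-- The defining property of acceleration fixes the ground instances, so nothing about the
particular technique or theory is needed. -/
theorem accel {φ : CHC L unary} {W : _root_.Language Letter} (h : Represents φ W)
    {accel : CHC L unary → CHC L unary} (ha : IsAcceleration accel) :
    Represents (accel φ) (kplus W) := by
  obtain ⟨h₁, h₂, h₃⟩ := ha φ h.recursive h.conjunctive
  refine ⟨h₁, h₂, ?_, h.admissible.kplus⟩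
  rw [h₃]
  ext g
  simp only [Set.mem_iUnion]
  constructor
  · rintro ⟨n, hn, hg⟩
    obtain ⟨n, rfl⟩ := Nat.exists_eq_add_of_le' hn
    rw [h.grnd_replicate] at hg
    obtain ⟨x, w, hw, rfl⟩ := hg
    exact ⟨x, w, ⟨n + 1, hn, hw⟩, rfl⟩
  · rintro ⟨x, w, ⟨n, hn, hw⟩, rfl⟩
    refine ⟨n, hn, ?_⟩
    obtain ⟨n, rfl⟩ := Nat.exists_eq_add_of_le' hn
    rw [h.grnd_replicate]
    exact ⟨x, w, hw, rfl⟩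

end Represents

theorem Appends.red_accel {φ : CHC L unary} (h : Appends φ)
    {accel : CHC L unary → CHC L unary} (ha : IsAcceleration accel) : φ.Red (accel φ) := by
  obtain ⟨W, h⟩ := h
  rw [h.red_iff (h.accel ha)]
  exact fun w hw => ⟨1, le_rfl, by rwa [pow_one]⟩

theorem Appends.accel {φ : CHC L unary} (h : Appends φ)
    {accel : CHC L unary → CHC L unary} (ha : IsAcceleration accel) : Appends (accel φ) :=
  ⟨_, h.choose_spec.accel ha⟩

theorem Appends.resSeq {t : List (CHC L unary)} (ht : t ≠ []) (h : ∀ φ ∈ t, Appends φ) :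
    Appends (CHC.resSeq t) := by
  induction t using List.reverseRecOn with
  | nil => exact absurd rfl ht
  | append_singleton t φ ih =>
    rcases eq_or_ne t [] with rfl | ht'
    · exact h φ (by simp)
    · rw [CHC.resSeq_append_singleton ht']
      obtain ⟨W, hW⟩ := ih ht' fun π hπ => h π (by simp [hπ])
      obtain ⟨V, hV⟩ := h φ (by simp)
      exact ⟨_, hW.res hV⟩

/-- The clauses that the calculus starts with: a fact for `0`, a query for the negative numbers,
and a rule for every letter. -/
structure InitialClauses (f q : CHC L unary) (ℓ : Letter → CHC L unary) : Prop where
  fact : f.IsFact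
  fact_conjunctive : f.IsConjunctive
  fact_grnd : f.grnd = {(none, some (pt 0))}
  query : q.IsQuery
  query_conjunctive : q.IsConjunctive
  query_grnd : q.grnd = {g | ∃ x < 0, g = (some (pt x), none)}
  letter : ∀ c, Represents (ℓ c) {[c]}

/-- A trace starting with the fact derives exactly codes of words, at least one of them. Hence such
traces are satisfiable, never enable the query, and derive only positive numbers once a rule has
been used. -/
theorem InitialClauses.grnd_trace {f q : CHC L unary} {ℓ : Letter → CHC L unary}
    (h : InitialClauses f q ℓ) (t : List (CHC L unary)) (ht : ∀ φ ∈ t, Appends φ) :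
    ∃ W : Set (List Letter), W.Nonempty ∧ (t ≠ [] → [] ∉ W) ∧
      (CHC.resSeq (f :: t)).grnd = {g | ∃ w ∈ W, g = (none, some (pt (appendWord 0 w)))} := by
  induction t using List.reverseRecOn with
  | nil => exact ⟨{[]}, by simp, by simp, by simp [CHC.resSeq, h.fact_grnd]⟩
  | append_singleton t φ ih =>
    obtain ⟨W, ⟨w, hw⟩, -, e⟩ := ih fun π hπ => ht π (by simp [hπ])
    obtain ⟨V, hV⟩ := ht φ (by simp)
    obtain ⟨v, hv⟩ := hV.admissible.nonempty
    refine ⟨{u | ∃ w ∈ W, ∃ v ∈ V, w ++ v = u}, ⟨_, w, hw, v, hv, rfl⟩, ?_, ?_⟩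
    · rintro - ⟨w, -, v, hv, e⟩
      rw [List.append_eq_nil_iff] at e
      exact hV.admissible.nil_notMem (e.2 ▸ hv)
    · rw [← List.cons_append, CHC.resSeq_append_singleton (by simp)]
      ext g
      rw [CHC.mem_grnd_res, e, hV.grnd_eq]
      constructor
      · rintro ⟨a, ⟨w, hw, e₁⟩, ⟨x, v, hv, e₂⟩⟩
        obtain ⟨d₁, d₂⟩ := Prod.mk.inj e₁
        obtain ⟨d₃, d₄⟩ := Prod.mk.inj e₂
        obtain rfl := pt_injective (Option.some.inj (d₂.symm.trans d₃))
        exact ⟨_, ⟨w, hw, v, hv, rfl⟩, Prod.ext d₁ (by rw [d₄, appendWord_append])⟩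
      · rintro ⟨_, ⟨w, hw, v, hv, rfl⟩, rfl⟩
        exact ⟨_, ⟨w, hw, rfl⟩, ⟨_, v, hv, by rw [appendWord_append]⟩⟩

end Representation

/-! ### The initial problem in linear integer arithmetic -/

section InitialProblem

/-- The integer constants as terms. -/
def numeral : ℕ → LIA.Term ℕ
  | 0 => .func (l := 0) LIAFunc.zero ![]
  | n + 1 => .func (l := 2) LIAFunc.add ![numeral n, .func (l := 0) LIAFunc.one ![] ]

/-- Sums of terms. -/
def sumTerm (s t : LIA.Term ℕ) : LIA.Term ℕ := .func (l := 2) LIAFunc.add ![s, t]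

@[simp]
theorem realize_sumTerm (s t : LIA.Term ℕ) (σ : ℕ → ℤ) :
    (sumTerm s t).realize σ = s.realize σ + t.realize σ := rfl

@[simp]
theorem realize_numeral (n : ℕ) (σ : ℕ → ℤ) : (numeral n).realize σ = n := by
  induction n with
  | zero => rfl
  | succ n ih =>
    rw [Nat.cast_succ, ← ih]
    rfl

/-- The fact `x = 0 ⟹ F(x)`. -/
def factClause : CHC LIA unary where
  body := none
  cond := [.lit (.eq (.var 0) (numeral 0))]
  head := some ⟨(), [0]⟩
  body_arity := by simp
  head_arity := by simp
  nodup := by simp [argVars]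

/-- The query `F(x) ∧ x + 1 ≤ 0 ⟹ ⊥`. -/
def queryClause : CHC LIA unary where
  body := some ⟨(), [0]⟩
  cond := [.lit (.rel (n := 2) LIARel.le ![sumTerm (.var 0) (numeral 1), numeral 0])]
  head := none
  body_arity := by simp
  head_arity := by simp
  nodup := by simp [argVars]

/-- The rule `F(x) ∧ y = x + x + x + x + c ⟹ F(y)`. -/
def letterClause (c : Letter) : CHC LIA unary where
  body := some ⟨(), [0]⟩
  cond := [.lit (.eq (.var 1) (sumTerm (sumTerm (sumTerm (.var 0) (.var 0))
    (sumTerm (.var 0) (.var 0))) (numeral c.digit)))]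
  head := some ⟨(), [1]⟩
  body_arity := by simp
  head_arity := by simp
  nodup := by simp [argVars]

theorem grnd_factClause : factClause.grnd = {(none, some (pt 0))} := by
  ext g
  simp only [CHC.grnd, CHC.CondHolds, factClause, List.mem_singleton, forall_eq, NNF.Holds,
    Literal.Holds, realize_numeral, Language.Term.realize_var, Nat.cast_zero, Set.mem_ofPred_eq,
    Option.map_none, Option.map_some, Atom.ground, List.map_cons, List.map_nil,
    Set.mem_singleton_iff, pt]
  constructor
  · rintro ⟨σ, h, rfl⟩
    rw [h]
  · rintro rfl
    exact ⟨fun _ => 0, rfl, rfl⟩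

theorem condHolds_queryClause (σ : ℕ → ℤ) : queryClause.CondHolds σ ↔ σ 0 < 0 := by
  simp only [CHC.CondHolds, queryClause, List.mem_singleton, forall_eq, NNF.Holds, Literal.Holds]
  change σ 0 + (numeral 1).realize σ ≤ (numeral 0).realize σ ↔ _
  simp only [realize_numeral]
  push_cast
  omega

theorem grnd_queryClause : queryClause.grnd = {g | ∃ x < 0, g = (some (pt x), none)} := by
  ext g
  simp only [CHC.grnd, condHolds_queryClause]
  constructor
  · rintro ⟨σ, h, rfl⟩
    exact ⟨σ 0, h, rfl⟩
  · rintro ⟨x, h, rfl⟩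
    exact ⟨fun _ => x, h, rfl⟩

theorem condHolds_letterClause (c : Letter) (σ : ℕ → ℤ) :
    (letterClause c).CondHolds σ ↔ σ 1 = 4 * σ 0 + c.digit := by
  simp only [CHC.CondHolds, letterClause, List.mem_singleton, forall_eq, NNF.Holds,
    Literal.Holds, realize_sumTerm, realize_numeral, Language.Term.realize_var]
  constructor <;> intro h <;> rw [h] <;> ring

theorem grnd_letterClause (c : Letter) : (letterClause c).grnd = wordRel {[c]} := by
  ext g
  simp only [CHC.grnd, condHolds_letterClause]
  constructor
  · rintro ⟨σ, h, rfl⟩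
    refine ⟨σ 0, [c], rfl, ?_⟩
    rw [appendWord_singleton, ← h]
    rfl
  · rintro ⟨x, w, rfl, rfl⟩
    exact ⟨fun n => if n = 0 then x else 4 * x + c.digit, rfl, rfl⟩

/-- The fact, the query, and the rules for all letters. -/
def initialProblem : Set (CHC LIA unary) := {factClause, queryClause} ∪ Set.range letterClause

theorem finite_initialProblem : initialProblem.Finite :=
  (Set.toFinite _).union (Set.finite_range _)

theorem satisfiable_initialProblem : Satisfiable initialProblem := by
  refine ⟨fun a => ∃ x ≥ 0, a = pt x, ?_⟩
  rintro φ ((rfl | rfl) | ⟨c, rfl⟩) σ hb hc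
  · have h : σ 0 = ((0 : ℕ) : ℤ) := by
      rw [← realize_numeral 0 σ]
      exact hc _ List.mem_cons_self
    exact ⟨_, rfl, σ 0, by simp [h], rfl⟩
  · rw [condHolds_queryClause] at hc
    obtain ⟨x, hx, e⟩ := hb _ rfl
    obtain rfl : σ 0 = x := pt_injective e
    omega
  · rw [condHolds_letterClause] at hc
    obtain ⟨x, hx, e⟩ := hb _ rfl
    obtain rfl : σ 0 = x := pt_injective e
    exact ⟨_, rfl, σ 1, by omega, rfl⟩

variable {L : FirstOrder.Language.{u, v}} [L.Structure ℤ]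

theorem initialClauses_map (i : LIA →ᴸ L) [i.IsExpansionOn ℤ] :
    InitialClauses (factClause.map i) (queryClause.map i) (fun c => (letterClause c).map i) where
  fact := ⟨rfl, by simp [CHC.map, factClause]⟩
  fact_conjunctive := CHC.IsConjunctive.map (by simp [CHC.IsConjunctive, factClause]) i
  fact_grnd := by rw [CHC.grnd_map, grnd_factClause]
  query := ⟨by simp [CHC.map, queryClause], rfl⟩
  query_conjunctive := CHC.IsConjunctive.map (by simp [CHC.IsConjunctive, queryClause]) i
  query_grnd := by rw [CHC.grnd_map, grnd_queryClause]
  letter c :=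
    { recursive := ⟨_, rfl, _, rfl, rfl⟩
      conjunctive := CHC.IsConjunctive.map (by simp [CHC.IsConjunctive, letterClause]) i
      grnd_eq := by rw [CHC.grnd_map, grnd_letterClause]
      admissible := Admissible.singleton c }

end InitialProblem

/-! ### The invariant of reasonable derivations -/

section Invariant

theorem bt_iff {L : FirstOrder.Language.{u, v}} {P : Type} {ar : P → ℕ} {C : Set (CHC L ar)}
    {t : List (CHC L ar)} {B : List (Set (CHC L ar))} {c' : Config L ar} :
    Bt (.state C t B) c' ↔ ∃ t' φ B' b b', t = t' ++ [φ] ∧ B = B' ++ [b, b'] ∧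
      c' = .state C t' (B' ++ [b ∪ {φ}]) := by
  constructor
  · intro h
    cases h
    exact ⟨_, _, _, _, _, rfl, rfl, rfl⟩
  · rintro ⟨t', φ, B', b, b', rfl, rfl, rfl⟩
    exact .mk C t' φ B' b b'

variable {L : FirstOrder.Language.{u, v}} [L.Structure ℤ]

theorem CHC.SRed.red {φ π : CHC L unary} (h : φ.SRed π) : φ.Red π := subset_of_ssubset h

theorem SRedSet.redSet {φ : CHC L unary} {C : Set (CHC L unary)} (h : SRedSet φ C) :
    RedSet φ C :=
  h.imp fun _ h => ⟨h.1, h.2.red⟩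

theorem RedSet.mono {φ : CHC L unary} {C D : Set (CHC L unary)} (h : RedSet φ C) (hCD : C ⊆ D) :
    RedSet φ D :=
  h.imp fun _ h => ⟨hCD h.1, h.2⟩

theorem SRedSet.mono {φ : CHC L unary} {C D : Set (CHC L unary)} (h : SRedSet φ C)
    (hCD : C ⊆ D) : SRedSet φ D :=
  h.imp fun _ h => ⟨hCD h.1, h.2⟩

theorem RedSet.of_red {φ π : CHC L unary} {C : Set (CHC L unary)} (h : RedSet π C)
    (hr : φ.Red π) : RedSet φ C :=
  h.imp fun _ h => ⟨h.1, hr.trans h.2⟩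

theorem blocked_append_singleton {B : List (Set (CHC L unary))} {X : Set (CHC L unary)}
    {φ : CHC L unary} : Blocked (B ++ [X]) φ ↔ RedSet φ X := by
  simp [Blocked]

/-- Nothing above a maximal clause is strictly redundant. Applied to a clause that blocks a maximal
one, this excludes strict redundancy as the reason for blocking. -/
theorem exists_red_maximal {C : Set (CHC L unary)} (hC : C.Finite) {φ : CHC L unary}
    (hφ : φ ∈ C) : ∃ π ∈ C, φ.Red π ∧ ∀ ρ, π.Red ρ → ¬ SRedSet ρ C := by
  obtain ⟨m, hm, ⟨π, hπ, rfl⟩, hmax⟩ :=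
    (hC.image CHC.grnd).exists_le_maximal (Set.mem_image_of_mem _ hφ)
  refine ⟨π, hπ, hm, ?_⟩
  rintro ρ hρ ⟨π', hπ', hs⟩
  exact hs.2 ((hmax ⟨π', hπ', rfl⟩ (hρ.trans hs.1)).trans hρ)

/-- The invariant for the set of clauses of a state. -/
structure ClausesInv (f q : CHC L unary) (ℓ : Letter → CHC L unary) (C : Set (CHC L unary)) :
    Prop where
  finite : C.Finite
  fact_mem : f ∈ C
  letter_mem : ∀ c, ℓ c ∈ C
  cases : ∀ φ ∈ C, φ = f ∨ φ = q ∨ Appends φ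

/-- Blocking `b` after the fact is justified. -/
def JustifiedOne (ℓ : Letter → CHC L unary) (C : Set (CHC L unary)) (b : CHC L unary) : Prop :=
  SRedSet b C ∨ ∀ c, RedSet (CHC.res b (ℓ c)) C ∨ (ℓ c).Red b

/-- Blocking `b` after the fact and the rule `p` is justified. -/
def JustifiedTwo (C : Set (CHC L unary)) (p b : CHC L unary) : Prop :=
  b.Red p ∨ SRedSet b C ∨ RedSet (CHC.res p b) C

/-- The invariant for the trace and the blocking clauses of a state with non-empty trace. -/
structure TraceInv (f : CHC L unary) (ℓ : Letter → CHC L unary) (C : Set (CHC L unary))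
    (t : List (CHC L unary)) (B : List (Set (CHC L unary))) : Prop where
  head : ∃ r, t = f :: r ∧ ∀ φ ∈ r, Appends φ
  length : B.length = t.length + 1
  one : ∀ X, B[1]? = some X → ∀ b ∈ X, Appends b ∧ JustifiedOne ℓ C b
  two : ∀ p, t[1]? = some p → ∀ X, B[2]? = some X → ∀ b ∈ X, Appends b ∧ JustifiedTwo C p b
  three : ∀ p p', t[1]? = some p → t[2]? = some p' → RedSet (CHC.res p p') C ∨
    t.length = 3 ∧ ∀ X, B[3]? = some X → ∀ b ∈ X, b.Red p'

theorem JustifiedOne.mono {ℓ : Letter → CHC L unary} {C D : Set (CHC L unary)}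
    {b : CHC L unary} (h : JustifiedOne ℓ C b) (hCD : C ⊆ D) : JustifiedOne ℓ D b :=
  h.imp (·.mono hCD) fun h c => (h c).imp_left (·.mono hCD)

theorem JustifiedTwo.mono {C D : Set (CHC L unary)} {p b : CHC L unary}
    (h : JustifiedTwo C p b) (hCD : C ⊆ D) : JustifiedTwo D p b :=
  h.imp_right (·.imp (·.mono hCD) (·.mono hCD))

/-- The invariant for the states of derivations from `Φ`. -/
def ConfigInv (f q : CHC L unary) (ℓ : Letter → CHC L unary) (Φ : Set (CHC L unary)) :
    Config L unary → Prop
  | .problem Ψ => Ψ = Φ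
  | .state C t B => ClausesInv f q ℓ C ∧ (t = [] ∧ B = [∅] ∨ TraceInv f ℓ C t B)
  | .sat => False
  | .unsat => False

variable {f q : CHC L unary} {ℓ : Letter → CHC L unary} {C : Set (CHC L unary)}
  {t : List (CHC L unary)} {B : List (Set (CHC L unary))}

theorem ClausesInv.sip_eq (h : InitialClauses f q ℓ) (hC : ClausesInv f q ℓ C) : sip C = C := by
  refine sip_eq_self fun φ hφ => ?_
  rcases hC.cases φ hφ with rfl | rfl | ⟨W, hW⟩
  · refine ⟨h.fact_conjunctive, ?_⟩
    rw [CHC.condSat_iff_grnd_nonempty, h.fact_grnd]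
    exact Set.singleton_nonempty _
  · refine ⟨h.query_conjunctive, ?_⟩
    rw [CHC.condSat_iff_grnd_nonempty, h.query_grnd]
    exact ⟨_, -1, by omega, rfl⟩
  · exact ⟨hW.conjunctive, hW.condSat⟩

theorem ClausesInv.appends_of_red (h : InitialClauses f q ℓ) (hC : ClausesInv f q ℓ C)
    {φ π : CHC L unary} (hφ : Appends φ) (hπ : π ∈ C) (hr : φ.Red π) : Appends π := by
  obtain ⟨W, hW⟩ := hφ
  obtain ⟨w, hw⟩ := hW.admissible.nonempty
  have hg : (some (pt 0), some (pt (appendWord 0 w))) ∈ π.grnd :=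
    hr (by rw [hW.grnd_eq]; exact ⟨0, w, hw, rfl⟩)
  rcases hC.cases π hπ with rfl | rfl | hp
  · rw [h.fact_grnd] at hg
    simp at hg
  · rw [h.query_grnd] at hg
    obtain ⟨x, -, e⟩ := hg
    simp at e
  · exact hp

theorem ClausesInv.union (hC : ClausesInv f q ℓ C) {φ : CHC L unary} (hφ : Appends φ) :
    ClausesInv f q ℓ (C ∪ {φ}) where
  finite := hC.finite.union (Set.finite_singleton _)
  fact_mem := Or.inl hC.fact_mem
  letter_mem c := Or.inl (hC.letter_mem c)
  cases := by
    rintro π (hπ | rfl)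
    · exact hC.cases π hπ
    · exact Or.inr (Or.inr hφ)

/-- Appending a word is always possible, so only blocking can make such a rule inactive. -/
theorem active_iff_of_appends (h : InitialClauses f q ℓ) {r : List (CHC L unary)}
    (hr : ∀ φ ∈ r, Appends φ) {φ : CHC L unary} (hφ : Appends φ) :
    Active (f :: r) B φ ↔ ¬ Blocked B φ := by
  refine and_iff_left ?_
  obtain ⟨W, ⟨w, hw⟩, -, e⟩ := h.grnd_trace (r ++ [φ]) (by
    intro π hπ
    rcases List.mem_append.1 hπ with hπ | hπ
    · exact hr π hπ
    · rwa [List.mem_singleton.1 hπ])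
  rw [CHC.condSat_iff_grnd_nonempty, List.cons_append, e]
  exact ⟨_, w, hw, rfl⟩

/-- Only rules can be appended to a trace that consists of the fact and further rules. -/
theorem Active.appends (h : InitialClauses f q ℓ) (hC : ClausesInv f q ℓ C)
    {r : List (CHC L unary)} (hr : ∀ φ ∈ r, Appends φ) {φ : CHC L unary} (hφ : φ ∈ C)
    (ha : Active (f :: r) B φ) : Appends φ := by
  have hs := ha.2
  rw [CHC.condSat_iff_grnd_nonempty, CHC.resSeq_append_singleton (by simp)] at hs
  obtain ⟨g, hg⟩ := hs
  obtain ⟨a, h₁, h₂⟩ := CHC.mem_grnd_res.1 hg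
  rcases hC.cases φ hφ with rfl | rfl | hp
  · rw [h.fact_grnd] at h₂
    simp at h₂
  · rw [h.query_grnd] at h₂
    obtain ⟨x, hx, e⟩ := h₂
    obtain ⟨W, -, -, e'⟩ := h.grnd_trace r hr
    rw [e'] at h₁
    obtain ⟨w, -, e₁⟩ := h₁
    have e₂ : some a = some (pt x) := congrArg Prod.fst e
    have e₃ : some a = some (pt (appendWord 0 w)) := congrArg Prod.snd e₁
    have := pt_injective (Option.some.inj (e₂.symm.trans e₃))
    have := appendWord_zero_nonneg w
    omega
  · exact hp

/-- Among the clauses only the fact has instances without body atom. It is not strictly redundant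
w.r.t. itself, and with further rules the derived values are positive. -/
theorem not_coverable_fact_cons (h : InitialClauses f q ℓ) (hC : ClausesInv f q ℓ C)
    {r : List (CHC L unary)} (hr : ∀ φ ∈ r, Appends φ) : ¬ Coverable C (f :: r) := by
  rintro ⟨-, hcov⟩
  obtain ⟨W, ⟨w, hw⟩, hnil, e⟩ := h.grnd_trace r hr
  rw [hC.sip_eq h] at hcov
  have hred : RedSet (CHC.resSeq (f :: r)) C := hcov.elim SRedSet.redSet And.left
  have only_fact : ∀ π ∈ C, (CHC.resSeq (f :: r)).Red π → π = f := by
    intro π hπ hred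
    have hg : (none, some (pt (appendWord 0 w))) ∈ π.grnd := hred (by rw [e]; exact ⟨w, hw, rfl⟩)
    rcases hC.cases π hπ with rfl | rfl | ⟨V, hV⟩
    · rfl
    · rw [h.query_grnd] at hg
      obtain ⟨x, -, e⟩ := hg
      simp at e
    · rw [hV.grnd_eq] at hg
      obtain ⟨x, v, -, e⟩ := hg
      simp at e
  rcases eq_or_ne r [] with rfl | hr'
  · rcases hcov with ⟨π, hπ, hs⟩ | ⟨-, hlen⟩
    · obtain rfl := only_fact π hπ hs.red
      exact (ssubset_irrefl _ hs)
    · simp at hlen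
  · obtain ⟨π, hπ, hred⟩ := hred
    obtain rfl := only_fact π hπ hred
    have hg : (none, some (pt (appendWord 0 w))) ∈ π.grnd := hred (by rw [e]; exact ⟨w, hw, rfl⟩)
    rw [h.fact_grnd] at hg
    simp only [Set.mem_singleton_iff, Prod.mk.injEq, true_and, Option.some.injEq,
      pt_injective.eq_iff] at hg
    refine (appendWord_zero_pos (w := w) ?_).ne' hg
    rintro rfl
    exact hnil hr' hw

/-- If all rules are blocked after the fact, then every prefix of the infinite square-free word
is covered by one of the finitely many clauses. -/
theorem not_all_blocked_one (h : InitialClauses f q ℓ) (hC : ClausesInv f q ℓ C)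
    {X : Set (CHC L unary)} (hX : ∀ b ∈ X, Appends b ∧ JustifiedOne ℓ C b) :
    ¬ ∀ π ∈ C, Appends π → RedSet π X := by
  intro hblock
  have key : ∀ n, ∃ π ∈ C, ∃ W, Represents π W ∧ sqfreePrefix (n + 1) ∈ W := by
    intro n
    induction n with
    | zero => exact ⟨_, hC.letter_mem (sqfreeSeq 0), _, h.letter _, rfl⟩
    | succ n ih =>
      obtain ⟨π, hπ, W, hW, hw⟩ := ih
      -- Passing to a maximal clause leaves only the letterwise justification of its blocking
      -- clause; for the next letter of the infinite word it yields a clause covering the longer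
      -- prefix.
      obtain ⟨ρ, hρ, hr, hmax⟩ := exists_red_maximal hC.finite hπ
      obtain ⟨b, hb, hρb⟩ := hblock ρ hρ (hC.appends_of_red h ⟨W, hW⟩ hρ hr)
      obtain ⟨⟨V, hV⟩, hjust⟩ := hX b hb
      have hwV : sqfreePrefix (n + 1) ∈ V := (hW.red_iff hV).1 (hr.trans hρb) hw
      rcases (hjust.resolve_left (hmax b hρb)) (sqfreeSeq (n + 1)) with hred | hred
      · obtain ⟨π', hπ', hred⟩ := hred
        have hres := hV.res (h.letter (sqfreeSeq (n + 1)))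
        obtain ⟨V', hV'⟩ := hC.appends_of_red h ⟨_, hres⟩ hπ' hred
        refine ⟨π', hπ', V', hV', (hres.red_iff hV').1 hred ?_⟩
        rw [sqfreePrefix_succ]
        exact Language.append_mem_mul hwV rfl
      -- Otherwise `V` contains two square-free words, the prefix and the next letter alone. They
      -- must coincide, so the infinite word would start with a repeated letter.
      · have hmem : [sqfreeSeq (n + 1)] ∈ V := ((h.letter _).red_iff hV).1 hred rfl
        have e := hV.admissible.unique _ hwV _ hmem (squareFreeWord_sqfreePrefix _)
          (squareFreeWord_singleton _)
        obtain rfl : n = 0 := by simpa using congrArg List.length e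
        have e' : sqfreeSeq 0 = sqfreeSeq 1 := by simpa [sqfreePrefix] using e
        refine absurd ⟨[], [], ?_⟩ (squareFreeWord_sqfreePrefix 2 [sqfreeSeq 0] (by simp))
        simp [sqfreePrefix, List.range_succ, ← e']
  choose π hπ W hW hw using key
  have := hC.finite.to_subtype
  -- Different prefixes need different clauses, since each language has at most one square-free
  -- word.
  refine not_injective_infinite_finite (fun n => (⟨π n, hπ n⟩ : C)) fun m n hmn => ?_
  have hmn : π m = π n := congrArg Subtype.val hmn
  have hle : W m ≤ W n := ((hW m).red_iff (hW n)).1 (by rw [hmn]; exact subset_rfl)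
  have := (hW n).admissible.unique _ (hle (hw m)) _ (hw n) (squareFreeWord_sqfreePrefix _)
    (squareFreeWord_sqfreePrefix _)
  simpa using congrArg List.length this

/-- For a letter `c`, a maximal clause above its rule is blocked by some `b`, which is not strictly
redundant. Either `b`, and thus `c`, is redundant w.r.t. `p`, or the resolvent of `p` and `b`, and
thus that of `p` and `c`, is redundant. -/
theorem justifiedOne_of_all_blocked_two (h : InitialClauses f q ℓ) (hC : ClausesInv f q ℓ C)
    {p : CHC L unary} {X : Set (CHC L unary)}
    (hX : ∀ b ∈ X, Appends b ∧ JustifiedTwo C p b)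
    (hblock : ∀ π ∈ C, Appends π → RedSet π X) : JustifiedOne ℓ C p := by
  refine Or.inr fun c => ?_
  obtain ⟨ρ, hρ, hr, hmax⟩ := exists_red_maximal hC.finite (hC.letter_mem c)
  obtain ⟨b, hb, hρb⟩ := hblock ρ hρ (hC.appends_of_red h ⟨_, h.letter c⟩ hρ hr)
  rcases (hX b hb).2 with hbp | hs | hred
  · exact Or.inr ((hr.trans hρb).trans hbp)
  · exact absurd hs (hmax b hρb)
  · exact Or.inl (hred.of_red (CHC.Red.res subset_rfl (hr.trans hρb)))

/-- Two different letters would already be two square-free words of the language. -/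
theorem not_all_letters_red (h : InitialClauses f q ℓ) {p : CHC L unary} (hp : Appends p) :
    ¬ ∀ c, (ℓ c).Red p := by
  intro hall
  obtain ⟨W, hW⟩ := hp
  have hmem : ∀ c : Letter, [c] ∈ W := fun c => ((h.letter c).red_iff hW).1 (hall c) rfl
  have := hW.admissible.unique _ (hmem (false, false)) _ (hmem (true, true))
    (squareFreeWord_singleton _) (squareFreeWord_singleton _)
  simp at this

theorem TraceInv.step (h : InitialClauses f q ℓ) (hC : ClausesInv f q ℓ C)
    (hT : TraceInv f ℓ C t B) {accel : CHC L unary → CHC L unary} (ha : IsAcceleration accel)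
    {φ : CHC L unary} (hφ : Appends φ) (hcand : ¬ ∃ sfx, AccelCandidate accel C t sfx) :
    TraceInv f ℓ C (t ++ [φ]) (B ++ [∅]) := by
  obtain ⟨⟨r, rfl, hr⟩, hlen, h₁, h₂, h₃⟩ := hT
  refine ⟨⟨r ++ [φ], rfl, ?_⟩, by simp [hlen], ?_, ?_, ?_⟩
  · intro π hπ
    rcases List.mem_append.1 hπ with hπ | hπ
    · exact hr π hπ
    · rwa [List.mem_singleton.1 hπ]
  · intro X hX
    rw [List.getElem?_append_left (by simp [hlen])] at hX
    exact h₁ X hX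
  · rcases r with _ | ⟨p, r⟩
    · intro p _ X hX
      rw [List.getElem?_append_right (by simp [hlen])] at hX
      simp only [hlen, List.length_cons, List.length_nil] at hX
      obtain rfl : ∅ = X := by simpa using hX
      simp
    · intro p' hp' X hX
      rw [List.getElem?_append_left (by simp [hlen])] at hX
      exact h₂ p' hp' X hX
  · rcases r with _ | ⟨p, _ | ⟨p', r⟩⟩
    · simp
    · intro p₁ p₂ _ _
      refine Or.inr ⟨rfl, fun X hX => ?_⟩
      rw [List.getElem?_append_right (by simp [hlen])] at hX
      simp only [hlen, List.length_cons, List.length_nil] at hX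
      obtain rfl : ∅ = X := by simpa using hX
      simp
    · intro p₁ p₂ e₁ e₂
      obtain rfl : p = p₁ := Option.some.inj e₁
      obtain rfl : p' = p₂ := Option.some.inj e₂
      rcases h₃ p p' rfl rfl with hred | ⟨hl, -⟩
      · exact Or.inl hred
      · obtain rfl : r = [] := by simpa using hl
        left
        have hpp : Appends (CHC.resSeq [p, p']) :=
          Appends.resSeq (by simp) fun π hπ => hr π hπ
        -- If the resolvent of `p` and `p'` were not redundant, neither would be its acceleration,
        -- which subsumes it; then `[p, p']` would be an acceleration candidate and the step
        -- forbidden.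
        by_contra hn
        refine hcand ⟨[p, p'], List.suffix_cons _ _, hpp.choose_spec.recursive, fun hred => hn ?_⟩
        rw [hC.sip_eq h] at hred
        exact hred.of_red (hpp.red_accel ha)

/-- The new last blocking set is just `{φ}`. Both `JustifiedTwo` and the second alternative of
`TraceInv.three` allow for blocking a clause that is redundant w.r.t. the preceding one. -/
theorem TraceInv.accelerate {sfx : List (CHC L unary)} {B' : List (Set (CHC L unary))}
    (hT : TraceInv f ℓ C (t ++ sfx) (B ++ B')) (ht : t ≠ []) (hs : sfx ≠ [])
    (hlen : sfx.length = B'.length) {φ : CHC L unary} (hφ : Appends φ) :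
    TraceInv f ℓ (C ∪ {φ}) (t ++ [φ]) (B ++ [{φ}]) := by
  obtain ⟨r, rfl⟩ : ∃ r, t = f :: r := by
    obtain ⟨r, e, -⟩ := hT.head
    rcases t with _ | ⟨a, t⟩
    · exact absurd rfl ht
    · exact ⟨t, by rw [(List.cons.inj e).1]⟩
  obtain ⟨⟨r', e, hr'⟩, hlen', h₁, h₂, h₃⟩ := hT
  have hC : C ⊆ C ∪ {φ} := Set.subset_union_left
  have hs' : 0 < sfx.length := List.length_pos_iff.2 hs
  have hB : B.length = r.length + 2 := by
    simp only [List.length_append, List.length_cons] at hlen'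
    omega
  obtain rfl : r ++ sfx = r' := (List.cons.inj e).2
  refine ⟨⟨r ++ [φ], rfl, ?_⟩, by simp [hB], ?_, ?_, ?_⟩
  · intro π hπ
    rcases List.mem_append.1 hπ with hπ | hπ
    · exact hr' π (List.mem_append_left _ hπ)
    · rwa [List.mem_singleton.1 hπ]
  · intro X hX b hb
    rw [List.getElem?_append_left (by omega)] at hX
    have := h₁ X (by rwa [List.getElem?_append_left (by omega)]) b hb
    exact ⟨this.1, this.2.mono hC⟩
  · rcases r with _ | ⟨p, r⟩
    · intro p e X hX b hb
      rw [List.getElem?_append_right (by simp [hB])] at hX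
      simp only [hB, List.length_nil] at hX
      obtain rfl : {φ} = X := by simpa using hX
      obtain rfl : φ = p := by simpa using e
      obtain rfl : b = φ := hb
      exact ⟨hφ, Or.inl subset_rfl⟩
    · intro p' e X hX b hb
      rw [List.getElem?_append_left (by simp [hB])] at hX
      have := h₂ p' e X (by rwa [List.getElem?_append_left (by simp [hB])]) b hb
      exact ⟨this.1, this.2.mono hC⟩
  · rcases r with _ | ⟨p, _ | ⟨p', r⟩⟩
    · simp
    · intro p₁ p₂ _ e₂
      refine Or.inr ⟨rfl, fun X hX b hb => ?_⟩
      rw [List.getElem?_append_right (by simp [hB])] at hX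
      simp only [hB, List.length_cons, List.length_nil] at hX
      obtain rfl : {φ} = X := by simpa using hX
      obtain rfl : φ = p₂ := by simpa using e₂
      obtain rfl : b = φ := hb
      exact subset_rfl
    · intro p₁ p₂ e₁ e₂
      -- The kept prefix has at least three clauses and the accelerated suffix at least one, so the
      -- old trace was longer than three.
      rcases h₃ p₁ p₂ e₁ e₂ with hred | ⟨hl, -⟩
      · exact Or.inl (hred.mono hC)
      · simp only [List.length_append, List.length_cons] at hl
        omega

/-- Only the last remaining blocking set grows, so a justification is due only when the remaining
trace has one or two clauses. A remaining trace of length three came from a longer one, where the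
resolvent is already redundant. -/
theorem TraceInv.bt {φ : CHC L unary} {b b' : Set (CHC L unary)}
    (hT : TraceInv f ℓ C (t ++ [φ]) (B ++ [b, b'])) (ht : t ≠ [])
    (hone : t = [f] → JustifiedOne ℓ C φ) (htwo : ∀ p, t = [f, p] → JustifiedTwo C p φ) :
    TraceInv f ℓ C t (B ++ [b ∪ {φ}]) := by
  obtain ⟨r, rfl⟩ : ∃ r, t = f :: r := by
    obtain ⟨r, e, -⟩ := hT.head
    rcases t with _ | ⟨a, t⟩
    · exact absurd rfl ht
    · exact ⟨t, by rw [(List.cons.inj e).1]⟩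
  obtain ⟨⟨r', e, hr'⟩, hlen', h₁, h₂, h₃⟩ := hT
  have hB : B.length = r.length + 1 := by simpa using hlen'
  obtain rfl : r ++ [φ] = r' := (List.cons.inj e).2
  have hφ : Appends φ := hr' φ (by simp)
  refine ⟨⟨r, rfl, fun π hπ => hr' π (List.mem_append_left _ hπ)⟩, by simp [hB], ?_, ?_, ?_⟩
  · rcases r with _ | ⟨p, r⟩
    · intro X hX c hc
      have h₁' := h₁ b (by simp [hB])
      obtain rfl : b ∪ {φ} = X := by simpa [List.getElem?_append_right, hB] using hX
      rcases hc with hc | rfl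
      · exact h₁' c hc
      · exact ⟨hφ, hone rfl⟩
    · intro X hX
      rw [List.getElem?_append_left (by simp [hB])] at hX
      exact h₁ X (by rwa [List.getElem?_append_left (by simp [hB])])
  · rcases r with _ | ⟨p, _ | ⟨p', r⟩⟩
    · simp
    · intro p₁ e₁ X hX c hc
      obtain rfl : p = p₁ := by simpa using e₁
      have h₂' := h₂ p rfl b (by simp [hB])
      obtain rfl : b ∪ {φ} = X := by simpa [List.getElem?_append_right, hB] using hX
      rcases hc with hc | rfl
      · exact h₂' c hc
      · exact ⟨hφ, htwo p rfl⟩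
    · intro p₁ e₁ X hX
      rw [List.getElem?_append_left (by simp [hB])] at hX
      exact h₂ p₁ e₁ X (by rwa [List.getElem?_append_left (by simp [hB])])
  · rcases r with _ | ⟨p, _ | ⟨p', r⟩⟩
    · simp
    · simp
    · intro p₁ p₂ e₁ e₂
      rcases h₃ p₁ p₂ e₁ e₂ with hred | ⟨hl, -⟩
      · exact Or.inl hred
      · simp at hl

theorem exists_bt (hT : TraceInv f ℓ C t B) : ∃ c', Bt (.state C t B) c' := by
  obtain ⟨⟨r, ht, -⟩, hlen, -⟩ := hT
  obtain ⟨t', φ, rfl⟩ := (List.eq_nil_or_concat t).resolve_left (by simp [ht])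
  rcases List.eq_nil_or_concat B with rfl | ⟨B₁, b', rfl⟩
  · simp at hlen
  rcases List.eq_nil_or_concat B₁ with rfl | ⟨B', b, rfl⟩
  · simp at hlen
  exact ⟨_, bt_iff.2 ⟨t', φ, B', b, b', by simp, by simp, rfl⟩⟩

/-- The suffix cannot contain the fact. For short traces it is either the last clause, which must
then be strictly redundant, or the two rules after the fact, whose resolvent is redundant. -/
theorem TraceInv.covered (h : InitialClauses f q ℓ) (hC : ClausesInv f q ℓ C)
    {t₀ sfx : List (CHC L unary)} {φ : CHC L unary} {b b' : Set (CHC L unary)}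
    (hT : TraceInv f ℓ C (t ++ [φ]) (B ++ [b, b'])) (e : t₀ ++ sfx = t ++ [φ])
    (hcov : Coverable C sfx) : TraceInv f ℓ C t (B ++ [b ∪ {φ}]) := by
  obtain ⟨r, hr, hr'⟩ := hT.head
  have ht₀ : t₀ ≠ [] := by
    rintro rfl
    rw [List.nil_append] at e
    rw [e, hr] at hcov
    exact not_coverable_fact_cons h hC hr' hcov
  obtain ⟨hs, hcov⟩ := hcov
  rw [hC.sip_eq h] at hcov
  have hred : RedSet (CHC.resSeq sfx) C := hcov.elim SRedSet.redSet And.left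
  refine hT.bt ?_ ?_ ?_
  · rintro rfl
    have := congrArg List.length e
    have := List.length_pos_iff.2 hs
    have := List.length_pos_iff.2 ht₀
    simp only [List.length_append, List.length_cons, List.length_nil] at *
    omega
  · rintro rfl
    left
    rcases t₀ with _ | ⟨a, _ | ⟨a', t₀⟩⟩
    · exact absurd rfl ht₀
    · simp only [List.cons_append, List.nil_append, List.cons.injEq] at e
      obtain ⟨rfl, rfl⟩ := e
      exact hcov.resolve_right (by simp)
    · have := congrArg List.length e
      have := List.length_pos_iff.2 hs
      simp only [List.length_append, List.length_cons, List.length_nil] at *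
      omega
  · rintro p rfl
    rcases t₀ with _ | ⟨a, _ | ⟨a', _ | ⟨a'', t₀⟩⟩⟩
    · exact absurd rfl ht₀
    · simp only [List.cons_append, List.nil_append, List.cons.injEq] at e
      obtain ⟨rfl, rfl⟩ := e
      exact Or.inr (Or.inr hred)
    · simp only [List.cons_append, List.nil_append, List.cons.injEq] at e
      obtain ⟨rfl, rfl, rfl⟩ := e
      exact Or.inr (Or.inl (hcov.resolve_right (by simp)))
    · have := congrArg List.length e
      have := List.length_pos_iff.2 hs
      simp only [List.length_append, List.length_cons, List.length_nil] at *
      omega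

theorem TraceInv.backtrack (h : InitialClauses f q ℓ) (hC : ClausesInv f q ℓ C)
    {φ : CHC L unary} {b b' : Set (CHC L unary)}
    (hT : TraceInv f ℓ C (t ++ [φ]) (B ++ [b, b']))
    (hinact : ∀ π ∈ C, π.IsRule ∨ π.IsQuery → ¬ Active (t ++ [φ]) (B ++ [b, b']) π) :
    TraceInv f ℓ C t (B ++ [b ∪ {φ}]) := by
  obtain ⟨r, hr, hr'⟩ := hT.head
  have hblock : ∀ π ∈ C, Appends π → RedSet π b' := by
    intro π hπ hp
    have := hinact π hπ (Or.inl (CHC.isRule_of_isRecursive hp.choose_spec.recursive))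
    rw [hr, active_iff_of_appends h hr' hp, not_not] at this
    rwa [← blocked_append_singleton (B := B ++ [b]), List.append_assoc]
  have hB : B.length = t.length := by simpa using hT.length
  refine hT.bt ?_ ?_ ?_
  · rintro rfl
    refine not_all_blocked_one h hC (hT.one b' ?_) hblock
    rw [List.length_nil] at hB
    simp [List.length_eq_zero_iff.1 hB]
  · rintro rfl
    refine justifiedOne_of_all_blocked_two h hC (hT.two φ rfl b' ?_) hblock
    simp [hB]
  · rintro p rfl
    -- If the resolvent is not known to be redundant, every blocking clause is redundant w.r.t. `φ`.
    -- With all letters blocked, `φ` would subsume every letter, which is impossible.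
    rcases hT.three p φ rfl rfl with hred | ⟨-, hX⟩
    · exact Or.inr (Or.inr hred)
    · have hX' := hX b' (by simp [hB])
      refine absurd (fun c => ?_) (not_all_letters_red h (p := φ) (hr' φ ?_))
      · obtain ⟨d, hd, hred⟩ := hblock _ (hC.letter_mem c) ⟨_, h.letter c⟩
        exact hred.trans (hX' d hd)
      · simp only [List.cons_append, List.cons.injEq, true_and] at hr
        simp [← hr]

/-! ### Preservation of the invariant and progress -/

theorem active_fact (h : InitialClauses f q ℓ) : Active [] [∅] f := by
  refine ⟨by simp [Blocked, RedSet], ?_⟩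
  rw [CHC.condSat_iff_grnd_nonempty]
  simp [CHC.resSeq, h.fact_grnd]

theorem ConfigInv.step (h : InitialClauses f q ℓ) {Φ : Set (CHC L unary)}
    (hΦ : ClausesInv f q ℓ Φ) {accel : CHC L unary → CHC L unary} (ha : IsAcceleration accel)
    {H : List (Config L unary)} {c c' : Config L unary} (hc : ConfigInv f q ℓ Φ c)
    (hs : RsStep accel H c c') : ConfigInv f q ℓ Φ c' := by
  obtain ⟨r, hstep, hrs⟩ := hs
  cases hstep with
  | init Ψ =>
    obtain rfl : Ψ = Φ := hc
    exact ⟨hΦ, Or.inl ⟨rfl, rfl⟩⟩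
  | step C t B φ hφ hact =>
    obtain ⟨hC, hT⟩ := hc
    rw [hC.sip_eq h] at hφ
    refine ⟨hC, Or.inr ?_⟩
    rcases hT with ⟨rfl, rfl⟩ | hT
    · obtain rfl : φ = f := by
        have hfact := hrs.start C _ φ rfl rfl
        rcases hC.cases φ hφ with rfl | rfl | hp
        · rfl
        · exact absurd (hfact.elim And.left And.left) h.query.1
        · exact absurd (hfact.elim And.left And.left)
            (CHC.isRule_of_isRecursive hp.choose_spec.recursive).1
      exact ⟨⟨[], rfl, by simp⟩, rfl, by simp, by simp, by simp⟩
    · obtain ⟨r, rfl, hr⟩ := hT.head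
      exact hT.step h hC ha (hact.appends h hC hr hφ) (hrs.accel_first C _ B φ rfl rfl)
  | accelerate C t sfx B B' φ hrec hlen hφ =>
    obtain ⟨hC, hT⟩ := hc
    have hsfx : sfx ≠ [] := by
      rintro rfl
      exact (CHC.isRule_of_isRecursive hrec).1 rfl
    rcases hT with ⟨ht, -⟩ | hT
    · exact absurd (List.append_eq_nil_iff.1 ht).2 hsfx
    · obtain ⟨r, e, hr⟩ := hT.head
      have ht : t ≠ [] := by
        rintro rfl
        rw [List.nil_append] at e
        rw [e] at hrec
        exact (CHC.isRule_of_isRecursive hrec).1 (CHC.body_resSeq_eq_none h.fact.1 r)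
      have happ : Appends (CHC.resSeq sfx) := by
        refine Appends.resSeq hsfx fun π hπ => hr π ?_
        obtain ⟨a, t, rfl⟩ := List.exists_cons_of_ne_nil ht
        rw [← (List.cons.inj e).2]
        exact List.mem_append_right _ hπ
      subst hφ
      exact ⟨hC.union (happ.accel ha),
        Or.inr (hT.accelerate ht hsfx hlen (happ.accel ha))⟩
  | covered C t sfx B c' hcov hbt =>
    obtain ⟨hC, hT⟩ := hc
    obtain ⟨t', φ, B', b, b', e, rfl, rfl⟩ := bt_iff.1 hbt
    rw [e] at hT
    rcases hT with ⟨ht, -⟩ | hT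
    · simp at ht
    · exact ⟨hC, Or.inr (hT.covered h hC e hcov)⟩
  | backtrack C t φ B c' hinact hq hbt =>
    obtain ⟨hC, hT⟩ := hc
    obtain ⟨t', φ', B', b, b', e, rfl, rfl⟩ := bt_iff.1 hbt
    rw [e] at hT hinact
    rw [hC.sip_eq h] at hinact
    rcases hT with ⟨ht, -⟩ | hT
    · simp at ht
    · exact ⟨hC, Or.inr (hT.backtrack h hC hinact)⟩
  | refute C t B href =>
    obtain ⟨hC, hT⟩ := hc
    obtain ⟨⟨hb, hh⟩, hs⟩ := href
    rw [CHC.condSat_iff_grnd_nonempty] at hs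
    rcases hT with ⟨rfl, -⟩ | hT
    · simp [CHC.resSeq] at hs
    · obtain ⟨r, rfl, hr⟩ := hT.head
      obtain ⟨W, -, -, e⟩ := h.grnd_trace r hr
      obtain ⟨g, hg⟩ := hs
      have hg' := hg
      rw [e] at hg
      obtain ⟨w, -, rfl⟩ := hg
      obtain ⟨σ, -, e'⟩ := hg'
      rw [hh] at e'
      simp at e'
  | prove C b hinact =>
    obtain ⟨hC, hT⟩ := hc
    rw [hC.sip_eq h] at hinact
    rcases hT with ⟨-, e⟩ | hT
    · rw [List.singleton_inj] at e
      subst e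
      exact hinact f hC.fact_mem (Or.inl h.fact) (active_fact h)
    · obtain ⟨r, e, -⟩ := hT.head
      simp at e

theorem Reasonable.of_not_coverForced {accel : CHC L unary → CHC L unary}
    {H : List (Config L unary)} {c : Config L unary} {r : Rule L unary}
    (hcov : ¬ CoverForced H c) (hstep : ∀ φ, r ≠ .step φ) (hacc : ∀ sfx, r ≠ .accelerate sfx) :
    Reasonable accel H c r where
  covered hf := absurd hf hcov
  accel_first _ _ _ φ _ e := absurd e (hstep φ)
  shortest _ _ _ sfx _ e := absurd e (hacc sfx)
  start _ _ φ _ e := absurd e (hstep φ)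

/-- The obligations of the strategy are met in order of priority: a forced covering, then the
shortest acceleration candidate, then a step. If nothing is active, backtracking applies because the
trace contains no query. -/
theorem ConfigInv.exists_rsStep (h : InitialClauses f q ℓ) {Φ : Set (CHC L unary)}
    (accel : CHC L unary → CHC L unary) (H : List (Config L unary)) {c : Config L unary}
    (hc : ConfigInv f q ℓ Φ c) : ∃ c', RsStep accel H c c' := by
  rcases c with Ψ | ⟨C, t, B⟩ | _ | _
  · refine ⟨_, .init, .init Ψ, .of_not_coverForced ?_ (by simp) (by simp)⟩
    rintro ⟨_, _, _, _, _, -, e, -⟩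
    cases e
  · obtain ⟨hC, hT⟩ := hc
    by_cases hcov : CoverForced H (.state C t B)
    · obtain ⟨C', t', sfx, -, B', -, e, hcov⟩ := hcov
      cases e
      rcases hT with ⟨ht, -⟩ | hT
      · exact absurd (List.append_eq_nil_iff.1 ht).2 hcov.1
      · obtain ⟨c', hbt⟩ := exists_bt hT
        exact ⟨c', .covered, .covered C t' sfx B c' hcov hbt, by simp, by simp, by simp, by simp⟩
    by_cases hacc : ∃ n sfx, AccelCandidate accel C t sfx ∧ sfx.length = n
    · classical
      obtain ⟨sfx, hcand, hn⟩ := Nat.find_spec hacc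
      have hmin : ∀ sfx', AccelCandidate accel C t sfx' → sfx.length ≤ sfx'.length := by
        intro sfx' h'
        rw [hn]
        exact Nat.find_min' hacc ⟨sfx', h', rfl⟩
      obtain ⟨⟨t', rfl⟩, hrec, -⟩ := id hcand
      have hlen : sfx.length ≤ B.length := by
        rcases hT with ⟨ht, -⟩ | hT
        · simp [(List.append_eq_nil_iff.1 ht).2]
        · have := hT.length
          rw [List.length_append] at this
          omega
      -- The last `sfx.length` blocking sets are the ones that acceleration discards.
      rw [← List.take_append_drop (B.length - sfx.length) B] at hcov ⊢
      refine ⟨_, .accelerate sfx, .accelerate C t' sfx _ _ _ hrec ?_ rfl,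
        fun hf => absurd hf hcov, by simp, ?_, by simp⟩
      · rw [List.length_drop]
        omega
      · intro C₁ t₁ B₁ sfx₁ e e'
        cases e
        cases e'
        exact ⟨hcand, hmin⟩
    have hacc' : ¬ ∃ sfx, AccelCandidate accel C t sfx :=
      fun ⟨sfx, hs⟩ => hacc ⟨_, sfx, hs, rfl⟩
    have step : ∀ φ ∈ C, Active t B φ → (t = [] → φ.IsFact) →
        ∃ c', RsStep accel H (.state C t B) c' := by
      intro φ hφ hact hfact
      rw [← hC.sip_eq h] at hφ
      refine ⟨_, .step φ, .step C t B φ hφ hact, fun hf => absurd hf hcov, ?_, by simp, ?_⟩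
      · intro C₁ t₁ B₁ φ₁ e _
        cases e
        exact hacc'
      · intro C₁ B₁ φ₁ e e'
        cases e
        cases e'
        exact Or.inl (hfact rfl)
    rcases hT with ⟨rfl, rfl⟩ | hT
    · exact step f hC.fact_mem (active_fact h) fun _ => h.fact
    · by_cases hact : ∃ π ∈ C, Active t B π
      · obtain ⟨π, hπ, hact⟩ := hact
        refine step π hπ hact fun ht => ?_
        obtain ⟨r, e, -⟩ := hT.head
        simp [ht] at e
      · obtain ⟨c', hbt⟩ := exists_bt hT
        obtain ⟨t', φ, B', b, b', rfl, rfl, rfl⟩ := bt_iff.1 hbt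
        refine ⟨_, .backtrack, .backtrack C t' φ _ _ ?_ ?_ hbt,
          .of_not_coverForced hcov (by simp) (by simp)⟩
        · intro π hπ _ ha
          rw [hC.sip_eq h] at hπ
          exact hact ⟨π, hπ, ha⟩
        · intro hq
          obtain ⟨r, e, hr⟩ := hT.head
          have hmem : φ ∈ f :: r := by rw [← e]; simp
          rcases List.mem_cons.1 hmem with rfl | hmem
          · exact hq.1 h.fact.1
          · exact (CHC.isRule_of_isRecursive (hr φ hmem).choose_spec.recursive).2 hq.2
  · exact hc.elim
  · exact hc.elim

theorem RsDeriv.configInv (h : InitialClauses f q ℓ) {Φ : Set (CHC L unary)}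
    (hΦ : ClausesInv f q ℓ Φ) {accel : CHC L unary → CHC L unary} (ha : IsAcceleration accel)
    {H : List (Config L unary)} {c : Config L unary} (hd : RsDeriv accel Φ H c) :
    ConfigInv f q ℓ Φ c := by
  induction hd with
  | start => exact rfl
  | snoc H c c' _ hs ih => exact ih.step h hΦ ha hs

end Invariant

/-- If every derivation with a reasonable strategy can be continued, then there is an infinite
one. -/
theorem exists_infinite_rsDeriv {L : FirstOrder.Language.{u, v}} [L.Structure ℤ] {P : Type}
    {ar : P → ℕ} {accel : CHC L ar → CHC L ar} {Φ : Set (CHC L ar)}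
    (hex : ∀ H c, RsDeriv accel Φ H c → ∃ c', RsStep accel H c c') :
    ∃ s : ℕ → Config L ar, s 0 = .problem Φ ∧
      ∀ n, RsStep accel ((List.range n).map s) (s n) (s (n + 1)) := by
  choose next hnext using hex
  let D := {x : List (Config L ar) × Config L ar // RsDeriv accel Φ x.1 x.2}
  -- The admissible choices depend on the whole past, so the recursion carries the history together
  -- with a proof that it is a derivation.
  let d : ℕ → D := fun n => Nat.rec ⟨([], .problem Φ), .start⟩
    (fun _ x => ⟨(x.1.1 ++ [x.1.2], next _ _ x.2), .snoc _ _ _ x.2 (hnext _ _ x.2)⟩) n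
  have hist : ∀ n, (d n).1.1 = (List.range n).map fun k => (d k).1.2 := by
    intro n
    induction n with
    | zero => rfl
    | succ n ih =>
      rw [List.range_succ, List.map_append, ← ih]
      rfl
  refine ⟨fun n => (d n).1.2, rfl, fun n => ?_⟩
  rw [← hist n]
  exact hnext _ _ (d n).2

/-! ### Conclusion -/

theorem clausesInv_initialProblem {L : FirstOrder.Language.{u, v}} [L.Structure ℤ]
    (i : LIA →ᴸ L) [i.IsExpansionOn ℤ] :
    ClausesInv (factClause.map i) (queryClause.map i) (fun c => (letterClause c).map i)
      (CHC.map i '' initialProblem) where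
  finite := finite_initialProblem.image _
  fact_mem := ⟨_, Or.inl (Or.inl rfl), rfl⟩
  letter_mem c := ⟨_, Or.inr ⟨c, rfl⟩, rfl⟩
  cases := by
    rintro _ ⟨φ, (rfl | rfl) | ⟨c, rfl⟩, rfl⟩
    · exact Or.inl rfl
    · exact Or.inr (Or.inl rfl)
    · exact Or.inr (Or.inr ⟨_, (initialClauses_map i).letter c⟩)

end ADCL

theorem theorem4 :
    ∃ (P : Type) (ar : P → ℕ) (Φ : Set (ADCL.CHC ADCL.LIA ar)),
      Φ.Finite ∧ ADCL.Satisfiable Φ ∧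
      ∀ (L : FirstOrder.Language.{u, v}) [L.Structure ℤ] (i : ADCL.LIA →ᴸ L)
        [i.IsExpansionOn ℤ] (accel : ADCL.CHC L ar → ADCL.CHC L ar),
        ADCL.IsAcceleration accel →
          -- no derivation with a reasonable strategy ends with `sat`
          (¬ ∃ h, ADCL.RsDeriv accel (ADCL.CHC.map i '' Φ) h ADCL.Config.sat) ∧
          -- no derivation with a reasonable strategy ends with a normal form
          (¬ ∃ h c, ADCL.RsDeriv accel (ADCL.CHC.map i '' Φ) h c ∧
            ∀ c', ¬ ADCL.RsStep accel h c c') ∧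
          -- there is an infinite derivation with a reasonable strategy
          (∃ s : ℕ → ADCL.Config L ar, s 0 = ADCL.Config.problem (ADCL.CHC.map i '' Φ) ∧
            ∀ n, ADCL.RsStep accel ((List.range n).map s) (s n) (s (n + 1))) := by
  refine ⟨Unit, ADCL.unary, ADCL.initialProblem, ADCL.finite_initialProblem,
    ADCL.satisfiable_initialProblem, fun L _ i _ accel ha => ?_⟩
  have h := ADCL.initialClauses_map i
  have hΦ := ADCL.clausesInv_initialProblem i
  have hex : ∀ H c, ADCL.RsDeriv accel (ADCL.CHC.map i '' ADCL.initialProblem) H c →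
      ∃ c', ADCL.RsStep accel H c c' :=
    fun H c hd => (hd.configInv h hΦ ha).exists_rsStep h accel H
  refine ⟨?_, ?_, ADCL.exists_infinite_rsDeriv hex⟩
  · rintro ⟨H, hd⟩
    exact hd.configInv h hΦ ha
  · rintro ⟨H, c, hd, hn⟩
    obtain ⟨c', hs⟩ := hex H c hd
    exact hn c' hs
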